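/- For a modulus $k\in(0,1)$ let $K(k)=\int_0^{\pi/2}\frac{d\theta}{\sqrt{1-k^2\sin^2\theta}}$, and let $\mathrm{sn}(\cdot;k)$ be the Jacobi elliptic sine, i.e. $\mathrm{sn}(u;k)=\sin\varphi$ where $\varphi\in\mathbb R$ is determined by $u=\int_0^{\varphi}\frac{d\theta}{\sqrt{1-k^2\sin^2\theta}}$. For $L>0$ and $s\ge 0$ let $H^s_{per,m}([0,L])$ be the space of real $L$-periodic functions $f\in L^2_{per}([0,L])$ with $\int_0^L f\,dx=0$ and $\|f\|_{H^s_{per}}^2=L\sum_{n\in\mathbb Z}(1+n^2)^s|\hat f(n)|^2<\infty$, where $\hat f(n)=\frac1L\int_0^L f(x)e^{-2\pi i n x/L}dx$, and let $H^\infty_{per,m}([0,L])=\bigcap_{s\ge0}H^s_{per,m}([0,L])$, with the topology given by all these norms. **Proposition 3.1.** Fix $L\in(0,2\pi)$ and let $$I_L=\Big\{c\in\mathbb R:\ \sqrt{1-\tfrac{L^2}{4\pi^2}}<|c|<1\Big\},$$ i.e. the set of speeds $c$ for which $\omega=1-c^2$ lies in $\big(0,\tfrac{L^2}{4\pi^2}\big)$.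 For every $c\in I_L$ there is a unique $k=k(c)\in(0,1)$ with $$\frac1{\sqrt{1-c^2}}=\frac{4K(k)\sqrt{1+k^2}}{L},$$ and, with this $k$, the function $$h_c(x)=\frac{\sqrt2\,k}{\sqrt{k^2+1}}\ \mathrm{sn}\!\left(\frac{x}{\sqrt{(1-c^2)(1+k^2)}};k\right),\qquad x\in\mathbb R,$$ is smooth, odd, $L$-periodic, belongs to $H^\infty_{per,m}([0,L])$, and satisfies $-(1-c^2)h_c''-h_c+h_c^3=0$ on $\mathbb R$. The map $c\mapsto h_c\in H^\infty_{per,m}([0,L])$ is smooth on $I_L$, that is, it is $C^\infty$ as a map from $I_L$ to $H^s_{per,m}([0,L])$ for every $s\ge0$. -/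

import Mathlib

open MeasureTheory AddCircle
open scoped ContDiff

noncomputable section

/-! ### Jacobi's elliptic function `sn` with modulus `k` -/

/-- The incomplete elliptic integral of the first kind,
`F(φ; k) = ∫₀^φ dθ / √(1 - k² sin² θ)`. -/
def ellipticF (k φ : ℝ) : ℝ :=
  ∫ θ in (0 : ℝ)..φ, 1 / √(1 - k ^ 2 * Real.sin θ ^ 2)

/-- The complete elliptic integral of the first kind, `K(k) = F(π/2; k)`. -/
def ellipticK (k : ℝ) : ℝ :=
  ∫ θ in (0 : ℝ)..(Real.pi / 2), 1 / √(1 - k ^ 2 * Real.sin θ ^ 2)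

/-- For a modulus `0 ≤ k < 1` the map `F(·; k)` is a bijection of the real line, so that its
inverse, Jacobi's amplitude, is well defined. -/
theorem ellipticF_bijective {k : ℝ} (h0 : 0 ≤ k) (h1 : k < 1) :
    Function.Bijective (ellipticF k) := by
  have hpos : ∀ θ : ℝ, 0 < 1 - k ^ 2 * Real.sin θ ^ 2 := fun θ => by
    have hs := Real.sin_sq_le_one θ
    have hk : k ^ 2 < 1 := by nlinarith
    nlinarith [sq_nonneg k, sq_nonneg (Real.sin θ)]
  have hcont : Continuous fun θ : ℝ => 1 / √(1 - k ^ 2 * Real.sin θ ^ 2) := by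
    refine Continuous.div continuous_const (by fun_prop) fun θ => ?_
    exact (Real.sqrt_pos.2 (hpos θ)).ne'
  have hge : ∀ θ : ℝ, 1 ≤ 1 / √(1 - k ^ 2 * Real.sin θ ^ 2) := fun θ => by
    rw [le_div_iff₀ (Real.sqrt_pos.2 (hpos θ)), one_mul, Real.sqrt_le_iff]
    refine ⟨zero_le_one, ?_⟩
    nlinarith [mul_nonneg (sq_nonneg k) (sq_nonneg (Real.sin θ))]
  have hgrow : ∀ a b : ℝ, a ≤ b → b - a ≤ ellipticF k b - ellipticF k a := fun a b hab => by
    unfold ellipticF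
    rw [intervalIntegral.integral_interval_sub_left (hcont.intervalIntegrable _ _)
      (hcont.intervalIntegrable _ _)]
    calc b - a = ∫ _θ in a..b, (1 : ℝ) := by simp
      _ ≤ _ := intervalIntegral.integral_mono_on hab (by simp) (hcont.intervalIntegrable _ _)
        fun θ _ => hge θ
  have hzero : ellipticF k 0 = 0 := by simp [ellipticF]
  have hFc : Continuous (ellipticF k) :=
    intervalIntegral.continuous_primitive (fun a b => hcont.intervalIntegrable a b) 0
  refine ⟨StrictMono.injective fun a b hab => ?_, ?_⟩
  · have := hgrow a b hab.le
    linarith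
  · refine hFc.surjective ?_ ?_
    · refine Filter.tendsto_atTop_mono' _ ?_ Filter.tendsto_id
      filter_upwards [Filter.eventually_ge_atTop (0 : ℝ)] with x hx
      have := hgrow 0 x hx
      simp only [id]
      linarith
    · refine Filter.tendsto_atBot_mono' _ ?_ Filter.tendsto_id
      filter_upwards [Filter.eventually_le_atBot (0 : ℝ)] with x hx
      have := hgrow x 0 hx
      simp only [id]
      linarith

/-- Jacobi's amplitude `am(·; k)`, the inverse function of `F(·; k)`. -/
def jacobiAm (u k : ℝ) : ℝ := Function.invFun (ellipticF k) u

/-- Jacobi's elliptic sine `sn(u; k) = sin (am(u; k))`. -/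
def jacobiSn (u k : ℝ) : ℝ := Real.sin (jacobiAm u k)

/-! ### Periodic Sobolev spaces of real functions

An `L`-periodic real function is a function on the circle `AddCircle L = ℝ / Lℤ`, and
`haarAddCircle` is the normalized measure `dx / L` on it.  Accordingly
`fourierCoeff g n = (1/L) ∫₀ᴸ g(x) exp(-2πi n x / L) dx`. -/

/-- The weight `√(L (1 + n²)^s)` of the `n`-th Fourier coefficient in the norm of `H^s_per`. -/
def sobolevWeight (L s : ℝ) (n : ℤ) : ℝ := √(L * (1 + (n : ℝ) ^ 2) ^ s)

theorem sobolevWeight_pos {L : ℝ} (hL : 0 < L) (s : ℝ) (n : ℤ) : 0 < sobolevWeight L s n := by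
  unfold sobolevWeight
  positivity

theorem sobolevWeight_sq {L : ℝ} (hL : 0 < L) (s : ℝ) (n : ℤ) :
    sobolevWeight L s n ^ 2 = L * (1 + (n : ℝ) ^ 2) ^ s := by
  unfold sobolevWeight
  rw [Real.sq_sqrt (by positivity)]

section Sobolev

variable (L : ℝ) [hL : Fact (0 < L)]

/-- `L²_per([0,L])`: square integrable real `L`-periodic functions (up to null sets). -/
abbrev L2per : Type := Lp ℝ 2 (haarAddCircle : Measure (AddCircle L))

variable {L}

/-- The periodic Fourier transform `f̂(n)` of a real function `f ∈ L²_per`. -/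
def fhat (f : L2per L) (n : ℤ) : ℂ :=
  fourierCoeff (fun x : AddCircle L => ((f x : ℝ) : ℂ)) n

/-- The same function regarded as a complex valued one (an auxiliary map). -/
def toComplexL2 : L2per L →L[ℝ] Lp ℂ 2 (haarAddCircle : Measure (AddCircle L)) :=
  Complex.ofRealCLM.compLpL 2 haarAddCircle

theorem fhat_eq_repr (f : L2per L) (n : ℤ) :
    fhat f n = fourierBasis.repr (toComplexL2 f) n := by
  rw [fourierBasis_repr]
  refine (congrFun (fourierCoeff_congr_ae ?_) n).symm
  exact Complex.ofRealCLM.coeFn_compLpL f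

theorem fhat_add (f g : L2per L) (n : ℤ) : fhat (f + g) n = fhat f n + fhat g n := by
  simp [fhat_eq_repr]

theorem fhat_smul (a : ℝ) (f : L2per L) (n : ℤ) : fhat (a • f) n = a • fhat f n := by
  have h : a • toComplexL2 f = (a : ℂ) • toComplexL2 f := (Complex.coe_smul a _).symm
  rw [fhat_eq_repr, fhat_eq_repr, map_smul, h, map_smul, ← Complex.coe_smul]
  rfl

theorem fhat_zero (n : ℤ) : fhat (0 : L2per L) n = 0 := by
  simp [fhat_eq_repr]

theorem fhat_injective {f : L2per L} (h : ∀ n, fhat f n = 0) : f = 0 := by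
  have h1 : fourierBasis.repr (toComplexL2 f) = 0 := by
    ext n
    rw [← fhat_eq_repr, h]
    rfl
  have h2 : toComplexL2 f = 0 := by simpa using h1
  have h3 := Complex.ofRealCLM.coeFn_compLpL (p := 2) (μ := haarAddCircle) f
  have h4 : (toComplexL2 f : AddCircle L → ℂ) =ᵐ[haarAddCircle] 0 := by
    rw [h2]
    exact Lp.coeFn_zero _ _ _
  refine (Lp.eq_zero_iff_ae_eq_zero).2 ?_
  filter_upwards [h3, h4] with x hx hx'
  have : ((f x : ℝ) : ℂ) = 0 := by
    have e : (toComplexL2 f : AddCircle L → ℂ) x = ((f x : ℝ) : ℂ) := hx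
    rw [← e, hx']
    rfl
  exact_mod_cast this

variable (L)

/-- The functions in `L²_per` with `L ∑ₙ (1 + n²)^s |f̂(n)|² < ∞`, see `mem_sobolevSubmodule`. -/
def sobolevSubmodule (s : ℝ) : Submodule ℝ (L2per L) where
  carrier := {f | Memℓp (fun n : ℤ => sobolevWeight L s n • fhat f n) 2}
  zero_mem' := by
    simp only [Set.mem_ofPred_eq, fhat_zero, smul_zero]
    exact zero_memℓp
  add_mem' := fun {f g} hf hg => by
    have := Memℓp.add hf hg
    simp only [Set.mem_ofPred_eq, fhat_add, smul_add]
    exact this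
  smul_mem' := fun a f hf => by
    have := Memℓp.const_smul hf a
    simp only [Set.mem_ofPred_eq, fhat_smul]
    convert this using 2 with n
    exact smul_comm _ _ _

theorem mem_sobolevSubmodule (s : ℝ) (f : L2per L) :
    f ∈ sobolevSubmodule L s ↔
      Summable fun n : ℤ => L * (1 + (n : ℝ) ^ 2) ^ s * ‖fhat f n‖ ^ 2 := by
  have h : f ∈ sobolevSubmodule L s ↔
      Memℓp (fun n : ℤ => sobolevWeight L s n • fhat f n) 2 := Iff.rfl
  rw [h, memℓp_gen_iff (by norm_num)]
  refine summable_congr fun n => ?_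
  rw [norm_smul, ENNReal.toReal_ofNat, Real.rpow_two, mul_pow, Real.norm_eq_abs, sq_abs,
    sobolevWeight_sq hL.out]

/-- The periodic Sobolev space `H^s_per([0,L])`, `s ≥ 0`.  It carries the Sobolev norm (and not
the norm of `L²_per`), see `Hper.norm_sq`. -/
def Hper (s : ℝ) : Type := sobolevSubmodule L s

namespace Hper

variable {L} {s : ℝ}

instance : AddCommGroup (Hper L s) := inferInstanceAs (AddCommGroup (sobolevSubmodule L s))

instance : Module ℝ (Hper L s) := inferInstanceAs (Module ℝ (sobolevSubmodule L s))

/-- The function in `L²_per` underlying an element of `H^s_per`. -/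
def toL2 : Hper L s →ₗ[ℝ] L2per L := (sobolevSubmodule L s).subtype

/-- An element of `L²_per` that satisfies the summability condition, as an element of `H^s_per`. -/
def mk (f : L2per L) (hf : f ∈ sobolevSubmodule L s) : Hper L s := ⟨f, hf⟩

/-- The sequence `√(L (1 + n²)^s) f̂(n)`, as an element of `ℓ²(ℤ)`. -/
def weighted : Hper L s →ₗ[ℝ] lp (fun _ : ℤ => ℂ) 2 where
  toFun f := ⟨fun n => sobolevWeight L s n • fhat f.toL2 n, f.2⟩
  map_add' f g := by
    ext n
    simp only [map_add, fhat_add, smul_add]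
    rfl
  map_smul' a f := by
    ext n
    simp only [map_smul, fhat_smul, RingHom.id_apply]
    exact smul_comm _ _ _

theorem weighted_injective : Function.Injective (weighted : Hper L s →ₗ[ℝ] _) := by
  rw [injective_iff_map_eq_zero]
  intro f hf
  refine Subtype.ext (fhat_injective fun n => ?_)
  have h : sobolevWeight L s n • fhat f.toL2 n = 0 := congrFun (congrArg Subtype.val hf) n
  exact (smul_eq_zero.1 h).resolve_left (sobolevWeight_pos hL.out s n).ne'

instance : NormedAddCommGroup (Hper L s) :=
  NormedAddCommGroup.induced (Hper L s) (lp (fun _ : ℤ => ℂ) 2) weighted weighted_injective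

instance : NormedSpace ℝ (Hper L s) :=
  NormedSpace.induced ℝ (Hper L s) (lp (fun _ : ℤ => ℂ) 2) weighted

theorem norm_sq (f : Hper L s) :
    ‖f‖ ^ 2 = L * ∑' n : ℤ, (1 + (n : ℝ) ^ 2) ^ s * ‖fhat f.toL2 n‖ ^ 2 := by
  have h : ‖f‖ = ‖weighted f‖ := rfl
  have h2 := lp.norm_rpow_eq_tsum (p := 2) (by norm_num) (weighted f)
  rw [ENNReal.toReal_ofNat, Real.rpow_two] at h2
  rw [h, h2, ← tsum_mul_left]
  refine tsum_congr fun n => ?_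
  have e : weighted f n = sobolevWeight L s n • fhat f.toL2 n := rfl
  rw [e, norm_smul, Real.rpow_two, mul_pow, Real.norm_eq_abs, sq_abs, sobolevWeight_sq hL.out,
    mul_assoc]

end Hper

theorem integrable_L2per (f : L2per L) : Integrable f haarAddCircle :=
  (Lp.memLp f).integrable (by norm_num)

/-- The functions in `L²_per` with `(1/L) ∫₀ᴸ f(x) dx = 0`. -/
def zeroMean : Submodule ℝ (L2per L) where
  carrier := {f | ∫ x, f x ∂haarAddCircle = 0}
  zero_mem' := by
    refine (integral_congr_ae (Lp.coeFn_zero _ _ _)).trans ?_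
    simp
  add_mem' := fun {f g} hf hg => by
    simp only [Set.mem_ofPred_eq] at hf hg ⊢
    rw [integral_congr_ae (Lp.coeFn_add f g)]
    simp only [Pi.add_apply]
    rw [integral_add (integrable_L2per L f) (integrable_L2per L g), hf, hg, add_zero]
  smul_mem' := fun a f hf => by
    simp only [Set.mem_ofPred_eq] at hf ⊢
    rw [integral_congr_ae (Lp.coeFn_smul a f)]
    simp only [Pi.smul_apply]
    rw [integral_smul, hf, smul_zero]

/-- The space `H^s_{per,m}([0,L])` of zero mean functions in `H^s_per`, with the norm of
`H^s_per`. -/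
abbrev Hperm (s : ℝ) : Type := (zeroMean L).comap (Hper.toL2 : Hper L s →ₗ[ℝ] L2per L)

/-- The space `H^∞_{per,m}([0,L]) = ⋂_{s ≥ 0} H^s_{per,m}([0,L])`. -/
def HInfperm : Submodule ℝ (L2per L) :=
  zeroMean L ⊓ ⨅ (s : ℝ) (_ : 0 ≤ s), sobolevSubmodule L s

variable {L}

theorem HInfperm.mem_sobolev (f : HInfperm L) {s : ℝ} (hs : 0 ≤ s) :
    (f : L2per L) ∈ sobolevSubmodule L s :=
  (Submodule.mem_iInf _).1 ((Submodule.mem_iInf _).1 (Submodule.mem_inf.1 f.2).2 s) hs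

/-- The inclusion of `H^∞_{per,m}` in `H^s_{per,m}`, for `s ≥ 0`. -/
def HInfperm.toHperm {s : ℝ} (hs : 0 ≤ s) (f : HInfperm L) : Hperm L s :=
  ⟨Hper.mk (f : L2per L) (HInfperm.mem_sobolev f hs), (Submodule.mem_inf.1 f.2).1⟩

/-- A curve in `H^∞_{per,m}` is smooth on `I` if it is smooth as a curve in each `H^s_{per,m}`,
`s ≥ 0`.  (The Fréchet space `H^∞_{per,m}` is the projective limit of these Hilbert spaces.) -/
def SmoothCurveOn (h : ℝ → HInfperm L) (I : Set ℝ) : Prop :=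
  ∀ (s : ℝ) (hs : 0 ≤ s), ContDiffOn ℝ ∞ (fun c => HInfperm.toHperm hs (h c)) I

/-- The `L`-periodic function `φ : ℝ → ℝ` is a representative of the class `f`. -/
def Represents (f : L2per L) (φ : ℝ → ℝ) : Prop :=
  Function.Periodic φ L ∧
    ∀ᵐ x ∂(volume.restrict (Set.Ioc 0 L)), f ((x : ℝ) : AddCircle L) = φ x

end Sobolev

/-- The snoidal profile
`x ↦ (√2 k / √(k² + 1)) sn(x / √((1 - c²)(1 + k²)); k)` with wave speed `c` and modulus `k`. -/
def snoidalWave (c k x : ℝ) : ℝ :=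
  √2 * k / √(k ^ 2 + 1) * jacobiSn (1 / √((1 - c ^ 2) * (1 + k ^ 2)) * x) k

end

/-! Put `q(k) = K(k) √(1 + k²)`. The equation for the modulus says `q(k) = L / (4 √(1 - c²))`, and
the right side exceeds `π/2` exactly when `1 - c² < L² / 4π²`. Now `q(0) = π/2`, `q` is strictly
increasing on `[0, 1)` and `K` diverges logarithmically at `1`, so `k(c)` exists and is unique
(`existsUnique_snoidalPeriod_eq`). Since `q' > 0`, the inverse function theorem makes `k(c)` smooth.

Inverting `(φ, k) ↦ (F(φ; k), k)` in the same way shows that `sn` is jointly smooth in argument and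
modulus (`contDiffAt_jacobiAm`). It is odd, has period `4K` and satisfies `sn'' = -(1 + k²) sn + 2k²
sn³`; scaling gives period `L` and the equation of the profile. Thus `W(c, x) = h_c(x)` is jointly
smooth, and each slice in `x` is smooth, odd and `L`-periodic.

Joint smoothness passes to smoothness into every `H^s` through one estimate. The operator `B = 1 -
(L/2π)² ∂ₓ²` multiplies the `n`-th Fourier coefficient by `1 + n²`, so for `s + 1 ≤ 2m` the `H^s`
norm is at most a constant times `sup |B^m f|` (`smoothOddPeriodic.exists_norm_toHs_le`). As `B`
commutes with `∂_c`, the first-order remainder of `B^m W` in `c`, uniform over `[0, L]`, controls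
the remainder of the curve in `H^s`. The derivative of the curve is therefore the curve of `∂_c W`,
a family of the same kind, and induction on the order finishes. -/

noncomputable section

/-! ### Smoothness of parametric integrals and of inverse functions -/

section Calculus

variable {E : Type} [NormedAddCommGroup E] [NormedSpace ℝ E] [ProperSpace E]

/-- Differentiation under the integral sign. As `E` is proper, a closed ball times `[0, 1]` is
compact, so the continuous partial derivative has a constant bound there, which serves as the
dominating function. -/
theorem hasFDerivAt_intervalIntegral_param {F : Type} [NormedAddCommGroup F] [NormedSpace ℝ F]
    [CompleteSpace F] {U : Set E} (hU : IsOpen U) {f : E × ℝ → F}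
    (hf : ContDiffOn ℝ 1 f (U ×ˢ Set.univ)) {p : E} (hp : p ∈ U) :
    HasFDerivAt (fun p => ∫ t in (0 : ℝ)..1, f (p, t))
      (∫ t in (0 : ℝ)..1, (fderiv ℝ f (p, t)).comp (ContinuousLinearMap.inl ℝ E ℝ)) p := by
  have hUo : IsOpen (U ×ˢ (Set.univ : Set ℝ)) := hU.prod isOpen_univ
  have hf' : ContinuousOn (fun q => (fderiv ℝ f q).comp (ContinuousLinearMap.inl ℝ E ℝ))
      (U ×ˢ Set.univ) :=
    (hf.continuousOn_fderiv_of_isOpen hUo le_rfl).clm_comp continuousOn_const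
  have hslice : ∀ q ∈ U, Continuous fun t : ℝ => f (q, t) := fun q hq =>
    hf.continuousOn.comp_continuous (by fun_prop) fun t => ⟨hq, trivial⟩
  have hslice' : Continuous fun t : ℝ =>
      (fderiv ℝ f (p, t)).comp (ContinuousLinearMap.inl ℝ E ℝ) :=
    hf'.comp_continuous (f := fun t : ℝ => (p, t)) (by fun_prop) fun t => ⟨hp, trivial⟩
  obtain ⟨r, hr, hrU⟩ := Metric.nhds_basis_closedBall.mem_iff.1 (hU.mem_nhds hp)
  obtain ⟨C, hC⟩ := ((isCompact_closedBall p r).prod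
    (isCompact_Icc (a := (0 : ℝ)) (b := 1))).exists_bound_of_continuousOn
      (hf'.mono (Set.prod_mono hrU (Set.subset_univ _)))
  refine intervalIntegral.hasFDerivAt_integral_of_dominated_of_fderiv_le
    (s := Metric.closedBall p r) (bound := fun _ => C)
    (F' := fun q t => (fderiv ℝ f (q, t)).comp (ContinuousLinearMap.inl ℝ E ℝ))
    (Metric.closedBall_mem_nhds p hr) ?_ ((hslice p hp).intervalIntegrable _ _)
    hslice'.aestronglyMeasurable ?_ (by simp) ?_
  · filter_upwards [hU.mem_nhds hp] with q hq
    exact (hslice q hq).aestronglyMeasurable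
  · refine Filter.Eventually.of_forall fun t ht q hq => hC (q, t) ⟨hq, ?_⟩
    rw [Set.uIoc_of_le zero_le_one] at ht
    exact Set.Ioc_subset_Icc_self ht
  · refine Filter.Eventually.of_forall fun t _ q hq => ?_
    have h1 : HasFDerivAt f (fderiv ℝ f (q, t)) (q, t) :=
      ((hf.contDiffAt (hUo.mem_nhds ⟨hrU hq, trivial⟩)).differentiableAt one_ne_zero).hasFDerivAt
    exact h1.comp q (hasFDerivAt_prodMk_left q t)

/-- The target `F` is quantified inside the induction because the derivative is again such an
integral, with values in `E →L[ℝ] F`. -/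
theorem contDiffOn_intervalIntegral_param {U : Set E} (hU : IsOpen U) (n : ℕ) :
    ∀ {F : Type} [NormedAddCommGroup F] [NormedSpace ℝ F] [CompleteSpace F] {f : E × ℝ → F},
      ContDiffOn ℝ ∞ f (U ×ˢ Set.univ) →
      ContDiffOn ℝ n (fun p => ∫ t in (0 : ℝ)..1, f (p, t)) U := by
  induction n with
  | zero =>
    intro F _ _ _ f hf
    refine contDiffOn_zero.2 fun p hp => ?_
    exact (hasFDerivAt_intervalIntegral_param hU (hf.of_le (by simp))
      hp).continuousAt.continuousWithinAt
  | succ n ih =>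
    intro F _ _ _ f hf
    have h := fun p (hp : p ∈ U) =>
      hasFDerivAt_intervalIntegral_param hU (hf.of_le (by simp)) hp
    rw [Nat.cast_succ, contDiffOn_succ_iff_fderiv_of_isOpen hU]
    refine ⟨fun p hp => (h p hp).differentiableAt.differentiableWithinAt, by simp, ?_⟩
    refine ContDiffOn.congr (ih (f := fun q => (fderiv ℝ f q).comp
      (ContinuousLinearMap.inl ℝ E ℝ)) ?_) fun p hp => (h p hp).fderiv
    exact (hf.fderiv_of_isOpen (hU.prod isOpen_univ) (by simp)).clm_comp contDiffOn_const

end Calculus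

/-- Near `f a`, any left inverse must agree with the local inverse supplied by the inverse function
theorem; no continuity of `g` is needed. -/
theorem ContDiffAt.of_eventually_leftInverse {E F : Type*} [NormedAddCommGroup E]
    [NormedSpace ℝ E] [CompleteSpace E] [NormedAddCommGroup F] [NormedSpace ℝ F] {n : ℕ∞ω}
    {f : E → F} {g : F → E} {f' : E ≃L[ℝ] F} {a : E} (hf : ContDiffAt ℝ n f a)
    (hf' : HasFDerivAt f (f' : E →L[ℝ] F) a) (hn : n ≠ 0) (hg : ∀ᶠ x in nhds a, g (f x) = x) :
    ContDiffAt ℝ n g (f a) := by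
  have hs := hf.hasStrictFDerivAt' hf' hn
  refine (hf.to_localInverse hf' hn).congr_of_eventuallyEq ?_
  have h1 := hs.eventually_right_inverse
  have h2 : Filter.Tendsto (hs.localInverse f f' a) (nhds (f a)) (nhds a) := by
    have := hs.localInverse_continuousAt
    rwa [ContinuousAt, hs.localInverse_apply_image] at this
  filter_upwards [h1, h2.eventually hg] with y hy hy'
  rw [hy] at hy'
  exact hy'

theorem contDiffAt_of_eventually_leftInverse_real {n : ℕ∞ω} {f g : ℝ → ℝ} {f' a : ℝ}
    (hf : ContDiffAt ℝ n f a) (hf' : HasDerivAt f f' a) (h0 : f' ≠ 0) (hn : n ≠ 0)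
    (hg : ∀ᶠ x in nhds a, g (f x) = x) : ContDiffAt ℝ n g (f a) := by
  refine ContDiffAt.of_eventually_leftInverse
    (f' := ContinuousLinearEquiv.unitsEquivAut ℝ (Units.mk0 f' h0)) hf ?_ hn hg
  refine hf'.hasFDerivAt.congr_fderiv ?_
  ext
  simp

/-! ### The elliptic integral and the elliptic sine -/

section Elliptic

theorem one_sub_sq_mul_sin_sq_pos {k : ℝ} (hk : k ^ 2 < 1) (θ : ℝ) :
    0 < 1 - k ^ 2 * Real.sin θ ^ 2 := by
  nlinarith [Real.sin_sq_le_one θ, sq_nonneg k, sq_nonneg (Real.sin θ)]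

theorem continuous_ellipticIntegrand {k : ℝ} (hk : k ^ 2 < 1) :
    Continuous fun θ : ℝ => 1 / √(1 - k ^ 2 * Real.sin θ ^ 2) :=
  Continuous.div continuous_const (by fun_prop) fun θ =>
    (Real.sqrt_pos.2 (one_sub_sq_mul_sin_sq_pos hk θ)).ne'

theorem intervalIntegrable_ellipticIntegrand {k : ℝ} (hk : k ^ 2 < 1) (a b : ℝ) :
    IntervalIntegrable (fun θ : ℝ => 1 / √(1 - k ^ 2 * Real.sin θ ^ 2)) volume a b :=
  (continuous_ellipticIntegrand hk).intervalIntegrable _ _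

theorem hasDerivAt_ellipticF {k : ℝ} (hk : k ^ 2 < 1) (φ : ℝ) :
    HasDerivAt (ellipticF k) (1 / √(1 - k ^ 2 * Real.sin φ ^ 2)) φ :=
  (continuous_ellipticIntegrand hk).integral_hasStrictDerivAt 0 φ |>.hasDerivAt

theorem isOpen_setOf_snd_sq_lt_one : IsOpen {p : ℝ × ℝ | p.2 ^ 2 < 1} :=
  isOpen_lt (by fun_prop) (by fun_prop)

theorem contDiffAt_ellipticF {p : ℝ × ℝ} (hp : p.2 ^ 2 < 1) :
    ContDiffAt ℝ ∞ (fun p : ℝ × ℝ => ellipticF p.2 p.1) p := by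
  -- The substitution `θ = φ t` fixes the interval at `[0, 1]` and turns the endpoint `φ` into a
  -- parameter of the integrand.
  have h : (fun p : ℝ × ℝ => ellipticF p.2 p.1) = fun p : ℝ × ℝ =>
      ∫ t in (0 : ℝ)..1, p.1 * (1 / √(1 - p.2 ^ 2 * Real.sin (p.1 * t) ^ 2)) := by
    funext p
    rw [intervalIntegral.integral_const_mul, intervalIntegral.mul_integral_comp_mul_left
      (f := fun θ => 1 / √(1 - p.2 ^ 2 * Real.sin θ ^ 2))]
    simp [ellipticF]
  rw [h]
  refine ContDiffOn.contDiffAt (contDiffOn_infty.2 fun n =>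
    contDiffOn_intervalIntegral_param isOpen_setOf_snd_sq_lt_one n
      (f := fun q : (ℝ × ℝ) × ℝ => q.1.1 * (1 / √(1 - q.1.2 ^ 2 * Real.sin (q.1.1 * q.2) ^ 2))) ?_)
    (isOpen_setOf_snd_sq_lt_one.mem_nhds hp)
  rintro q ⟨hq, -⟩
  have hq' := one_sub_sq_mul_sin_sq_pos (k := q.1.2) hq (q.1.1 * q.2)
  have hs : ContDiff ℝ ∞ fun q : (ℝ × ℝ) × ℝ => 1 - q.1.2 ^ 2 * Real.sin (q.1.1 * q.2) ^ 2 := by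
    fun_prop
  refine ContDiffAt.contDiffWithinAt (ContDiffAt.mul (by fun_prop)
    (ContDiffAt.div contDiffAt_const (hs.contDiffAt.sqrt hq'.ne') (Real.sqrt_pos.2 hq').ne'))

theorem contDiffAt_ellipticK {k : ℝ} (hk : k ^ 2 < 1) : ContDiffAt ℝ ∞ ellipticK k :=
  (contDiffAt_ellipticF (p := (Real.pi / 2, k)) hk).comp k (by fun_prop)

theorem ellipticF_jacobiAm {k : ℝ} (h0 : 0 ≤ k) (h1 : k < 1) (u : ℝ) :
    ellipticF k (jacobiAm u k) = u :=
  Function.invFun_eq ((ellipticF_bijective h0 h1).surjective u)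

theorem jacobiAm_ellipticF {k : ℝ} (h0 : 0 ≤ k) (h1 : k < 1) (φ : ℝ) :
    jacobiAm (ellipticF k φ) k = φ :=
  Function.leftInverse_invFun (ellipticF_bijective h0 h1).injective φ

/-- The map `(φ, k) ↦ (F(φ; k), k)` has a triangular differential whose diagonal entry `∂F/∂φ` is
positive, and `(u, k) ↦ (am(u; k), k)` is a left inverse of it. Requiring `0 < k` keeps nearby
moduli in the range where `am` inverts `F`. -/
theorem contDiffAt_jacobiAm {u k : ℝ} (h0 : 0 < k) (h1 : k < 1) :
    ContDiffAt ℝ ∞ (fun p : ℝ × ℝ => jacobiAm p.1 p.2) (u, k) := by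
  have hk : k ^ 2 < 1 := by nlinarith
  set φ := jacobiAm u k with hφ
  have hF := contDiffAt_ellipticF (p := (φ, k)) hk
  set A := fderiv ℝ (fun p : ℝ × ℝ => ellipticF p.2 p.1) (φ, k) with hA
  have hFA : HasFDerivAt (fun p : ℝ × ℝ => ellipticF p.2 p.1) A (φ, k) :=
    (hF.differentiableAt (by simp)).hasFDerivAt
  set a := A (1, 0) with ha
  set b := A (0, 1) with hb
  have ha0 : a ≠ 0 := by
    have h2 : HasDerivAt (ellipticF k) a φ := by
      have := hFA.comp_hasDerivAt (f := fun s : ℝ => (s, k)) φ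
        ((hasDerivAt_id φ).prodMk (hasDerivAt_const φ k))
      exact this
    rw [h2.unique (hasDerivAt_ellipticF hk φ)]
    have := Real.sqrt_pos.2 (one_sub_sq_mul_sin_sq_pos hk φ)
    positivity
  have hAv : ∀ v : ℝ × ℝ, A v = a * v.1 + b * v.2 := by
    intro v
    have : v = v.1 • ((1, 0) : ℝ × ℝ) + v.2 • ((0, 1) : ℝ × ℝ) := by ext <;> simp
    conv_lhs => rw [this]
    rw [map_add, map_smul, map_smul, smul_eq_mul, smul_eq_mul, ← ha, ← hb]
    ring
  -- The differential `(v₁, v₂) ↦ (a v₁ + b v₂, v₂)` has inverse `(w₁, w₂) ↦ ((w₁ - b w₂) / a, w₂)`.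
  let e : (ℝ × ℝ) ≃L[ℝ] (ℝ × ℝ) := ContinuousLinearEquiv.equivOfInverse
    (A.prod (ContinuousLinearMap.snd ℝ ℝ ℝ))
    ((a⁻¹ • (ContinuousLinearMap.fst ℝ ℝ ℝ - b • ContinuousLinearMap.snd ℝ ℝ ℝ)).prod
      (ContinuousLinearMap.snd ℝ ℝ ℝ))
    (fun v => by ext <;> simp [hAv]; field_simp)
    (fun v => by ext <;> simp [hAv]; field_simp; ring)
  have h := ContDiffAt.of_eventually_leftInverse (n := ∞)
    (f := fun p : ℝ × ℝ => (ellipticF p.2 p.1, p.2))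
    (g := fun p : ℝ × ℝ => (jacobiAm p.1 p.2, p.2)) (f' := e) (a := (φ, k))
    (hF.prodMk contDiffAt_snd) (hFA.prodMk hasFDerivAt_snd) (by simp) (by
      have h3 : ∀ᶠ p : ℝ × ℝ in nhds (φ, k), 0 < p.2 ∧ p.2 < 1 :=
        ((isOpen_lt continuous_const continuous_snd).inter
          (isOpen_lt continuous_snd continuous_const)).mem_nhds ⟨h0, h1⟩
      filter_upwards [h3] with p hp
      simp [jacobiAm_ellipticF hp.1.le hp.2])
  simp only [hφ, ellipticF_jacobiAm h0.le h1] at h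
  exact contDiffAt_fst.comp (u, k) h

theorem contDiffAt_jacobiSn {u k : ℝ} (h0 : 0 < k) (h1 : k < 1) :
    ContDiffAt ℝ ∞ (fun p : ℝ × ℝ => jacobiSn p.1 p.2) (u, k) :=
  (contDiffAt_jacobiAm h0 h1).sin

theorem hasDerivAt_jacobiAm {k : ℝ} (h0 : 0 < k) (h1 : k < 1) (u : ℝ) :
    HasDerivAt (fun u => jacobiAm u k) (√(1 - k ^ 2 * jacobiSn u k ^ 2)) u := by
  have hk : k ^ 2 < 1 := by nlinarith
  have hpos := Real.sqrt_pos.2 (one_sub_sq_mul_sin_sq_pos hk (jacobiAm u k))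
  have hc : ContinuousAt (fun u => jacobiAm u k) u :=
    ((contDiffAt_jacobiAm (u := u) h0 h1).comp u
      (f := fun u => (u, k)) (by fun_prop)).continuousAt
  have := (hasDerivAt_ellipticF hk (jacobiAm u k)).of_local_left_inverse hc (by positivity)
    (Filter.Eventually.of_forall fun v => ellipticF_jacobiAm h0.le h1 v)
  simpa [jacobiSn] using this

theorem hasDerivAt_jacobiSn {k : ℝ} (h0 : 0 < k) (h1 : k < 1) (u : ℝ) :
    HasDerivAt (fun u => jacobiSn u k)
      (Real.cos (jacobiAm u k) * √(1 - k ^ 2 * jacobiSn u k ^ 2)) u :=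
  (hasDerivAt_jacobiAm h0 h1 u).sin

/-- In classical notation `sn' = cn dn`, `cn' = -sn dn` and `dn' = -k² sn cn`; the squares of `cn`
and `dn` are then eliminated in favour of `sn`. -/
theorem hasDerivAt_deriv_jacobiSn {k : ℝ} (h0 : 0 < k) (h1 : k < 1) (u : ℝ) :
    HasDerivAt (fun u => Real.cos (jacobiAm u k) * √(1 - k ^ 2 * jacobiSn u k ^ 2))
      (-(1 + k ^ 2) * jacobiSn u k + 2 * k ^ 2 * jacobiSn u k ^ 3) u := by
  have hk : k ^ 2 < 1 := by nlinarith
  have hpos : 0 < 1 - k ^ 2 * jacobiSn u k ^ 2 := one_sub_sq_mul_sin_sq_pos hk (jacobiAm u k)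
  have hs := (((hasDerivAt_jacobiSn h0 h1 u).pow 2).const_mul (k ^ 2)).const_sub 1
  refine ((hasDerivAt_jacobiAm h0 h1 u).cos.mul (hs.sqrt hpos.ne')).congr_deriv ?_
  have hsq := Real.sq_sqrt hpos.le
  have hc : Real.cos (jacobiAm u k) ^ 2 = 1 - jacobiSn u k ^ 2 := by
    rw [Real.cos_sq']; rfl
  have hsn : Real.sin (jacobiAm u k) = jacobiSn u k := rfl
  have h3 := Real.sqrt_pos.2 hpos
  simp only [Pi.pow_apply, hsn]
  set d := √(1 - k ^ 2 * jacobiSn u k ^ 2)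
  set y := jacobiSn u k
  set z := Real.cos (jacobiAm u k)
  have e : -y * d * d + z * (-(k ^ 2 * ((2 : ℕ) * y ^ (2 - 1) * (z * d))) / (2 * d))
      = -y * d ^ 2 - k ^ 2 * y * z ^ 2 := by
    field_simp
    push_cast
    ring
  rw [e, hsq, hc]
  ring

theorem ellipticF_neg (k φ : ℝ) : ellipticF k (-φ) = -ellipticF k φ := by
  have h := intervalIntegral.integral_comp_neg (a := 0) (b := φ)
    (fun θ : ℝ => 1 / √(1 - k ^ 2 * Real.sin θ ^ 2))
  have h2 := intervalIntegral.integral_symm (μ := volume)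
    (f := fun θ : ℝ => 1 / √(1 - k ^ 2 * Real.sin θ ^ 2)) (-φ) 0
  simp only [Real.sin_neg, neg_sq, neg_zero] at h
  unfold ellipticF
  linarith

/-- The reflection `θ ↦ π - θ` preserves the integrand and exchanges the two halves of `[0, π]`. -/
theorem ellipticF_pi {k : ℝ} (hk : k ^ 2 < 1) : ellipticF k Real.pi = 2 * ellipticK k := by
  have h := intervalIntegral.integral_comp_sub_left (a := 0) (b := Real.pi / 2)
    (fun θ : ℝ => 1 / √(1 - k ^ 2 * Real.sin θ ^ 2)) Real.pi
  simp only [Real.sin_pi_sub, sub_zero] at h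
  rw [show Real.pi - Real.pi / 2 = Real.pi / 2 by ring] at h
  have h2 := intervalIntegral.integral_add_adjacent_intervals
    (intervalIntegrable_ellipticIntegrand hk 0 (Real.pi / 2))
    (intervalIntegrable_ellipticIntegrand hk (Real.pi / 2) Real.pi)
  unfold ellipticF ellipticK
  linarith

theorem ellipticF_add_pi {k : ℝ} (hk : k ^ 2 < 1) (φ : ℝ) :
    ellipticF k (φ + Real.pi) = ellipticF k φ + 2 * ellipticK k := by
  have hp : Function.Periodic (fun θ : ℝ => 1 / √(1 - k ^ 2 * Real.sin θ ^ 2)) Real.pi := by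
    intro θ
    simp [Real.sin_add_pi]
  have h := hp.intervalIntegral_add_eq φ 0
  have h2 := intervalIntegral.integral_add_adjacent_intervals
    (intervalIntegrable_ellipticIntegrand hk 0 φ)
    (intervalIntegrable_ellipticIntegrand hk φ (φ + Real.pi))
  rw [h, zero_add] at h2
  rw [← ellipticF_pi hk]
  exact h2.symm

theorem jacobiAm_neg {k : ℝ} (h0 : 0 ≤ k) (h1 : k < 1) (u : ℝ) :
    jacobiAm (-u) k = -jacobiAm u k := by
  conv_lhs => rw [← ellipticF_jacobiAm h0 h1 u, ← ellipticF_neg, jacobiAm_ellipticF h0 h1]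

theorem jacobiAm_add {k : ℝ} (h0 : 0 ≤ k) (h1 : k < 1) (u : ℝ) :
    jacobiAm (u + 2 * ellipticK k) k = jacobiAm u k + Real.pi := by
  have hk : k ^ 2 < 1 := by nlinarith
  conv_lhs => rw [← ellipticF_jacobiAm h0 h1 u, ← ellipticF_add_pi hk, jacobiAm_ellipticF h0 h1]

theorem jacobiSn_neg {k : ℝ} (h0 : 0 ≤ k) (h1 : k < 1) (u : ℝ) :
    jacobiSn (-u) k = -jacobiSn u k := by
  rw [jacobiSn, jacobiAm_neg h0 h1, Real.sin_neg, jacobiSn]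

theorem jacobiSn_add {k : ℝ} (h0 : 0 ≤ k) (h1 : k < 1) (u : ℝ) :
    jacobiSn (u + 4 * ellipticK k) k = jacobiSn u k := by
  rw [show u + 4 * ellipticK k = u + 2 * ellipticK k + 2 * ellipticK k by ring, jacobiSn,
    jacobiAm_add h0 h1, jacobiAm_add h0 h1, Real.sin_add_pi, Real.sin_add_pi, neg_neg, jacobiSn]

/-! ### The complete elliptic integral as a function of the modulus -/

theorem ellipticK_zero : ellipticK 0 = Real.pi / 2 := by
  simp [ellipticK]

theorem ellipticK_mono {k l : ℝ} (hk : 0 ≤ k) (hkl : k ≤ l) (hl : l < 1) :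
    ellipticK k ≤ ellipticK l := by
  have hl2 : l ^ 2 < 1 := by nlinarith
  have hkl2 : k ^ 2 ≤ l ^ 2 := by nlinarith
  refine intervalIntegral.integral_mono_on (by positivity)
    (intervalIntegrable_ellipticIntegrand (hkl2.trans_lt hl2) _ _)
    (intervalIntegrable_ellipticIntegrand hl2 _ _) fun θ _ => ?_
  refine one_div_le_one_div_of_le (Real.sqrt_pos.2 (one_sub_sq_mul_sin_sq_pos hl2 θ))
    (Real.sqrt_le_sqrt ?_)
  nlinarith [sq_nonneg (Real.sin θ)]

theorem ellipticK_pos {k : ℝ} (hk : 0 ≤ k) (hk1 : k < 1) : 0 < ellipticK k := by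
  have := ellipticK_mono le_rfl hk hk1
  rw [ellipticK_zero] at this
  linarith [Real.pi_pos]

/-- Here `ε` is the complementary modulus. The radicand is `cos² θ + ε² sin² θ ≤ (ε + cos θ)²`, and
`cos θ ≤ π/2 - θ`. So the integrand is at least `1 / (ε + π/2 - θ)`, whose integral is the
logarithm. -/
theorem log_le_ellipticK {k ε : ℝ} (hε : 0 < ε) (hkε : k ^ 2 = 1 - ε ^ 2) :
    Real.log ((ε + Real.pi / 2) / ε) ≤ ellipticK k := by
  have hk : k ^ 2 < 1 := by nlinarith
  have hpi := Real.pi_pos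
  have h := intervalIntegral.integral_comp_sub_left (a := 0) (b := Real.pi / 2)
    (fun t : ℝ => 1 / t) (ε + Real.pi / 2)
  rw [sub_zero, add_sub_cancel_right,
    integral_one_div_of_pos hε (by positivity)] at h
  rw [← h]
  have hpos : ∀ θ ∈ Set.Icc 0 (Real.pi / 2), 0 < ε + Real.pi / 2 - θ := fun θ hθ => by
    linarith [hθ.2]
  refine intervalIntegral.integral_mono_on (by positivity) ?_
    (intervalIntegrable_ellipticIntegrand hk _ _) fun θ hθ => ?_
  · refine ContinuousOn.intervalIntegrable_of_Icc (by positivity) ?_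
    exact continuousOn_const.div (by fun_prop) fun θ hθ => (hpos θ hθ).ne'
  · refine one_div_le_one_div_of_le (Real.sqrt_pos.2 (one_sub_sq_mul_sin_sq_pos hk θ)) ?_
    refine Real.sqrt_le_iff.2 ⟨(hpos θ hθ).le, ?_⟩
    have h1 : Real.cos θ ≤ Real.pi / 2 - θ := by
      rw [← Real.sin_pi_div_two_sub]
      exact Real.sin_le (by linarith [hθ.2])
    have h2 : 0 ≤ Real.cos θ :=
      Real.cos_nonneg_of_mem_Icc ⟨by linarith [hθ.1], hθ.2⟩
    have h3 := Real.sin_sq_add_cos_sq θ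
    have h4 : 1 - k ^ 2 * Real.sin θ ^ 2 ≤ ε ^ 2 + Real.cos θ ^ 2 := by
      rw [hkε]
      nlinarith [mul_nonneg (sq_nonneg ε) (sq_nonneg (Real.cos θ))]
    nlinarith [mul_nonneg hε.le h2]

theorem exists_lt_ellipticK (M : ℝ) : ∃ k : ℝ, 0 < k ∧ k < 1 ∧ M < ellipticK k := by
  have h1 : Filter.Tendsto (fun ε : ℝ => (ε + Real.pi / 2) / ε) (nhdsWithin 0 (Set.Ioi 0))
      Filter.atTop := by
    have h2 : Filter.Tendsto (fun ε : ℝ => ε + Real.pi / 2) (nhdsWithin 0 (Set.Ioi 0))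
        (nhds (0 + Real.pi / 2)) :=
      (Continuous.tendsto (by fun_prop) _).mono_left nhdsWithin_le_nhds
    exact h2.pos_mul_atTop (by positivity) tendsto_inv_nhdsGT_zero
  have h3 := (Real.tendsto_log_atTop.comp h1).eventually_gt_atTop M
  have h4 : ∀ᶠ ε : ℝ in nhdsWithin 0 (Set.Ioi 0), ε < 1 :=
    nhdsWithin_le_nhds (Iio_mem_nhds one_pos)
  obtain ⟨ε, hε, hε1, hεM⟩ := ((eventually_mem_nhdsWithin (a := (0 : ℝ)) (s := Set.Ioi 0)).and
    (h4.and h3)).exists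
  have hε0 : 0 < ε := hε
  have hp : 0 < 1 - ε ^ 2 := by nlinarith
  refine ⟨√(1 - ε ^ 2), Real.sqrt_pos.2 hp, ?_,
    hεM.trans_le (log_le_ellipticK hε0 (Real.sq_sqrt hp.le))⟩
  rw [Real.sqrt_lt' one_pos]
  nlinarith

/-- The function `k ↦ K(k) √(1 + k²)`, proportional to the period of the profile. -/
def snoidalPeriod (k : ℝ) : ℝ := ellipticK k * √(1 + k ^ 2)

theorem contDiffAt_snoidalPeriod {k : ℝ} (hk : k ^ 2 < 1) : ContDiffAt ℝ ∞ snoidalPeriod k :=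
  (contDiffAt_ellipticK hk).mul
    (ContDiffAt.sqrt (by fun_prop) (by positivity : (1 + k ^ 2 : ℝ) ≠ 0))

/-- Strictness comes from the factor `√(1 + k²)`, so weak monotonicity of `K` suffices. The same
holds for the sign of the derivative in `exists_hasDerivAt_snoidalPeriod`. -/
theorem strictMonoOn_snoidalPeriod : StrictMonoOn snoidalPeriod (Set.Ico 0 1) := by
  intro k hk l hl hkl
  have h1 := ellipticK_mono hk.1 hkl.le hl.2
  have h2 : √(1 + k ^ 2) < √(1 + l ^ 2) :=
    Real.sqrt_lt_sqrt (by positivity) (by nlinarith [hk.1])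
  exact mul_lt_mul' h1 h2 (Real.sqrt_nonneg _) (ellipticK_pos hl.1 hl.2)

theorem exists_hasDerivAt_snoidalPeriod {k : ℝ} (h0 : 0 < k) (h1 : k < 1) :
    ∃ d, 0 < d ∧ HasDerivAt snoidalPeriod d k := by
  have hk : k ^ 2 < 1 := by nlinarith
  have hK := ((contDiffAt_ellipticK hk).differentiableAt (by simp)).hasDerivAt
  have hs : HasDerivAt (fun k : ℝ => √(1 + k ^ 2)) (k / √(1 + k ^ 2)) k := by
    have := ((hasDerivAt_pow 2 k).const_add 1).sqrt (by positivity)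
    convert this using 1
    have : 0 < √(1 + k ^ 2) := by positivity
    field_simp
    ring
  have hd : 0 ≤ deriv ellipticK k := by
    have hm : MonotoneOn ellipticK (Set.Ioo 0 1) := fun a ha b hb hab =>
      ellipticK_mono ha.1.le hab hb.2
    rw [← derivWithin_of_mem_nhds (isOpen_Ioo.mem_nhds ⟨h0, h1⟩)]
    exact hm.derivWithin_nonneg
  have hKp := ellipticK_pos h0.le h1
  exact ⟨_, by positivity, hK.mul hs⟩

theorem existsUnique_snoidalPeriod_eq {y : ℝ} (hy : Real.pi / 2 < y) :
    ∃ k, (0 < k ∧ k < 1 ∧ snoidalPeriod k = y) ∧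
      ∀ l, 0 < l → l < 1 → snoidalPeriod l = y → l = k := by
  obtain ⟨k₁, h0, h1, hM⟩ := exists_lt_ellipticK y
  have hq0 : snoidalPeriod 0 = Real.pi / 2 := by simp [snoidalPeriod, ellipticK_zero]
  have hq1 : y ≤ snoidalPeriod k₁ := by
    have h2 : 1 ≤ √(1 + k₁ ^ 2) := Real.one_le_sqrt.2 (by nlinarith)
    have h3 := ellipticK_pos h0.le h1
    unfold snoidalPeriod
    nlinarith
  have hc : ContinuousOn snoidalPeriod (Set.Icc 0 k₁) := fun k hk =>
    (contDiffAt_snoidalPeriod (by nlinarith [hk.1, hk.2])).continuousAt.continuousWithinAt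
  obtain ⟨k, hk, hky⟩ := intermediate_value_Icc h0.le hc ⟨by linarith, hq1⟩
  have hk0 : 0 < k := by
    refine lt_of_le_of_ne hk.1 fun h => ?_
    rw [← h, hq0] at hky
    linarith
  refine ⟨k, ⟨hk0, hk.2.trans_lt h1, hky⟩, fun l hl0 hl1 hl => ?_⟩
  exact strictMonoOn_snoidalPeriod.injOn ⟨hl0.le, hl1⟩ ⟨hk0.le, hk.2.trans_lt h1⟩
    (hl.trans hky.symm)

end Elliptic

/-! ### Fourier coefficients of smooth periodic functions -/

section PeriodicCoeff

variable {L : ℝ} [hL : Fact (0 < L)]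

/-- The Fourier coefficients of a real function over the period `[0, L]`. -/
def periodicCoeff (L : ℝ) [hL : Fact (0 < L)] (f : ℝ → ℝ) (n : ℤ) : ℂ :=
  fourierCoeffOn hL.out (fun x => (f x : ℂ)) n

theorem periodicCoeff_eq_integral (f : ℝ → ℝ) (n : ℤ) :
    periodicCoeff L f n = (1 / L : ℝ) •
      ∫ x in (0 : ℝ)..L, Complex.exp (2 * Real.pi * Complex.I * (-n : ℤ) * x / L) * f x := by
  rw [periodicCoeff, fourierCoeffOn_eq_integral]
  simp only [fourier_coe_apply, smul_eq_mul, sub_zero]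

theorem fourierCoeff_lift_eq_periodicCoeff {f : ℝ → ℝ} (hf : Function.Periodic f L) (n : ℤ) :
    fourierCoeff (fun x : AddCircle L => ((hf.lift x : ℝ) : ℂ)) n = periodicCoeff L f n := by
  rw [periodicCoeff_eq_integral, fourierCoeff_eq_intervalIntegral _ n 0]
  simp only [fourier_coe_apply, smul_eq_mul, zero_add]
  rfl

theorem norm_periodicCoeff_le {f : ℝ → ℝ} {M : ℝ} (hM : ∀ x ∈ Set.Icc 0 L, |f x| ≤ M) (n : ℤ) :
    ‖periodicCoeff L f n‖ ≤ M := by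
  have hL0 : 0 < L := hL.out
  have h : ∀ x ∈ Set.uIoc 0 L,
      ‖Complex.exp (2 * Real.pi * Complex.I * (-n : ℤ) * x / L) * f x‖ ≤ M := by
    intro x hx
    rw [Set.uIoc_of_le hL0.le] at hx
    have h1 : (2 * Real.pi * Complex.I * (-n : ℤ) * x / L : ℂ)
        = ((2 * Real.pi * (-n : ℤ) * x / L : ℝ) : ℂ) * Complex.I := by
      push_cast
      ring
    rw [norm_mul, h1, Complex.norm_exp_ofReal_mul_I, one_mul, Complex.norm_real]
    exact hM x (Set.Ioc_subset_Icc_self hx)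
  have h2 := intervalIntegral.norm_integral_le_of_norm_le_const h
  rw [sub_zero, abs_of_pos hL0] at h2
  rw [periodicCoeff_eq_integral, norm_smul, Real.norm_of_nonneg (by positivity)]
  calc 1 / L * _ ≤ 1 / L * (M * L) := by gcongr
    _ = M := by field_simp

theorem Function.Periodic.periodic_deriv {f : ℝ → ℝ} {L : ℝ} (hf : Function.Periodic f L) :
    Function.Periodic (deriv f) L := by
  intro x
  rw [← deriv_comp_add_const]
  congr 1
  exact funext hf

theorem periodicCoeff_deriv {f : ℝ → ℝ} (hf : ContDiff ℝ 1 f) (hp : Function.Periodic f L)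
    (n : ℤ) :
    periodicCoeff L (deriv f) n = 2 * Real.pi * Complex.I * n / L * periodicCoeff L f n := by
  have hL0 : (L : ℂ) ≠ 0 := by exact_mod_cast hL.out.ne'
  have hd : ∀ x, HasDerivAt f (deriv f x) x := fun x =>
    (hf.differentiable one_ne_zero x).hasDerivAt
  have hc : Continuous (deriv f) := hf.continuous_deriv le_rfl
  have hfL : f L = f 0 := by simpa using hp 0
  -- The integration by parts formula divides by `n`, so the mean is treated apart. In both cases
  -- the boundary values cancel by periodicity.
  rcases eq_or_ne n 0 with rfl | hn
  · have h1 : (∫ x in (0 : ℝ)..L, deriv f x) = 0 := by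
      rw [intervalIntegral.integral_eq_sub_of_hasDerivAt (fun x _ => hd x)
        (hc.intervalIntegrable _ _), hfL, sub_self]
    have h2 : (∫ x in (0 : ℝ)..L, ((deriv f x : ℝ) : ℂ)) = 0 := by
      rw [intervalIntegral.integral_ofReal, h1, Complex.ofReal_zero]
    rw [periodicCoeff_eq_integral]
    simp [h2]
  · have h := fourierCoeffOn_of_hasDerivAt (f := fun x => (f x : ℂ))
      (f' := fun x => ((deriv f x : ℝ) : ℂ)) hL.out hn
      (fun x _ => (hd x).ofReal_comp)
      ((Complex.continuous_ofReal.comp hc).intervalIntegrable _ _)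
    have h' : periodicCoeff L f n = 1 / (-2 * Real.pi * Complex.I * n) *
        (0 - L * periodicCoeff L (deriv f) n) := by
      refine h.trans ?_
      rw [hfL]
      simp [periodicCoeff]
    have hn' : (n : ℂ) ≠ 0 := by exact_mod_cast hn
    have hpi : (Real.pi : ℂ) ≠ 0 := by exact_mod_cast Real.pi_ne_zero
    rw [h']
    field_simp
    ring

/-- The operator `1 - (L / 2π)² d²/dx²`, which multiplies the `n`-th Fourier coefficient by
`1 + n²`. -/
def besselOp (L : ℝ) (f : ℝ → ℝ) (x : ℝ) : ℝ :=
  f x - (L / (2 * Real.pi)) ^ 2 * deriv (deriv f) x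

theorem ContDiff.deriv_infty {f : ℝ → ℝ} (hf : ContDiff ℝ ∞ f) : ContDiff ℝ ∞ (deriv f) :=
  (contDiff_infty_iff_deriv.1 hf).2

theorem ContDiff.besselOp {f : ℝ → ℝ} (hf : ContDiff ℝ ∞ f) (L : ℝ) :
    ContDiff ℝ ∞ (besselOp L f) :=
  hf.sub (contDiff_const.mul hf.deriv_infty.deriv_infty)

theorem ContDiff.besselOp_iterate {f : ℝ → ℝ} (hf : ContDiff ℝ ∞ f) (L : ℝ) (m : ℕ) :
    ContDiff ℝ ∞ ((_root_.besselOp L)^[m] f) := by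
  induction m with
  | zero => exact hf
  | succ m ih =>
    rw [Function.iterate_succ_apply']
    exact ih.besselOp L

theorem Function.Periodic.besselOp {f : ℝ → ℝ} {T : ℝ} (hf : Function.Periodic f T) (L : ℝ) :
    Function.Periodic (besselOp L f) T := fun x => by
  rw [_root_.besselOp, hf, hf.periodic_deriv.periodic_deriv, _root_.besselOp]

theorem besselOp_add_smul {f g : ℝ → ℝ} (hf : ContDiff ℝ ∞ f) (hg : ContDiff ℝ ∞ g) (L a : ℝ) :
    besselOp L (f + a • g) = besselOp L f + a • besselOp L g := by
  have key : ∀ {f g : ℝ → ℝ}, ContDiff ℝ ∞ f → ContDiff ℝ ∞ g →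
      deriv (f + a • g) = deriv f + a • deriv g := by
    intro f g hf hg
    funext x
    have hf' := hf.differentiable (by simp) x
    have hg' := hg.differentiable (by simp) x
    rw [deriv_add hf' (hg'.const_smul a), deriv_const_smul a hg']
    rfl
  funext x
  simp only [besselOp, key hf hg, key hf.deriv_infty hg.deriv_infty, Pi.add_apply, Pi.smul_apply,
    smul_eq_mul]
  ring

theorem besselOp_iterate_add_smul {f g : ℝ → ℝ} (hf : ContDiff ℝ ∞ f) (hg : ContDiff ℝ ∞ g)
    (L a : ℝ) (m : ℕ) :
    (besselOp L)^[m] (f + a • g) = (besselOp L)^[m] f + a • (besselOp L)^[m] g := by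
  induction m with
  | zero => rfl
  | succ m ih =>
    simp only [Function.iterate_succ_apply', ih]
    exact besselOp_add_smul (hf.besselOp_iterate L m) (hg.besselOp_iterate L m) L a

theorem periodicCoeff_sub_mul {f g : ℝ → ℝ} (hf : Continuous f) (hg : Continuous g) (a : ℝ)
    (n : ℤ) :
    periodicCoeff L (fun x => f x - a * g x) n =
      periodicCoeff L f n - a * periodicCoeff L g n := by
  have h : ∀ {u : ℝ → ℝ}, Continuous u → IntervalIntegrable (fun x : ℝ =>
      Complex.exp (2 * Real.pi * Complex.I * (-n : ℤ) * x / L) * u x) volume 0 L := fun hu =>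
    Continuous.intervalIntegrable (by fun_prop) _ _
  simp only [periodicCoeff_eq_integral]
  have e : ∀ x : ℝ, Complex.exp (2 * Real.pi * Complex.I * (-n : ℤ) * x / L) *
      ((f x - a * g x : ℝ) : ℂ) =
      Complex.exp (2 * Real.pi * Complex.I * (-n : ℤ) * x / L) * f x -
      a * (Complex.exp (2 * Real.pi * Complex.I * (-n : ℤ) * x / L) * g x) := fun x => by
    push_cast
    ring
  simp only [e]
  rw [intervalIntegral.integral_sub (h hf) ((h hg).const_mul _),
    intervalIntegral.integral_const_mul, smul_sub, mul_smul_comm]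

theorem periodicCoeff_besselOp {f : ℝ → ℝ} (hf : ContDiff ℝ ∞ f) (hp : Function.Periodic f L)
    (n : ℤ) :
    periodicCoeff L (besselOp L f) n = (1 + (n : ℂ) ^ 2) * periodicCoeff L f n := by
  have hL0 : (L : ℂ) ≠ 0 := by exact_mod_cast hL.out.ne'
  have hpi : (Real.pi : ℂ) ≠ 0 := by exact_mod_cast Real.pi_ne_zero
  have h := periodicCoeff_sub_mul (L := L) hf.continuous hf.deriv_infty.deriv_infty.continuous
    ((L / (2 * Real.pi)) ^ 2) n
  rw [periodicCoeff_deriv (hf.deriv_infty.of_le (by simp)) hp.periodic_deriv,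
    periodicCoeff_deriv (hf.of_le (by simp)) hp] at h
  refine h.trans ?_
  push_cast
  field_simp
  rw [Complex.I_sq]
  ring

theorem periodicCoeff_besselOp_iterate {f : ℝ → ℝ} (hf : ContDiff ℝ ∞ f)
    (hp : Function.Periodic f L) (n : ℤ) (m : ℕ) :
    periodicCoeff L ((besselOp L)^[m] f) n = (1 + (n : ℂ) ^ 2) ^ m * periodicCoeff L f n := by
  induction m generalizing f with
  | zero => simp
  | succ m ih =>
    rw [Function.iterate_succ_apply, ih (hf.besselOp L) (hp.besselOp L),
      periodicCoeff_besselOp hf hp]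
    ring

theorem one_add_sq_pow_mul_norm_periodicCoeff_le {f : ℝ → ℝ} (hf : ContDiff ℝ ∞ f)
    (hp : Function.Periodic f L) {m : ℕ} {M : ℝ}
    (hM : ∀ x ∈ Set.Icc 0 L, |(besselOp L)^[m] f x| ≤ M) (n : ℤ) :
    (1 + (n : ℝ) ^ 2) ^ m * ‖periodicCoeff L f n‖ ≤ M := by
  have h := norm_periodicCoeff_le hM n
  have e : ‖(1 + (n : ℂ) ^ 2)‖ = 1 + (n : ℝ) ^ 2 := by
    have : (1 + (n : ℂ) ^ 2) = ((1 + (n : ℝ) ^ 2 : ℝ) : ℂ) := by push_cast; ring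
    rw [this, Complex.norm_real, Real.norm_of_nonneg (by positivity)]
  rwa [periodicCoeff_besselOp_iterate hf hp, norm_mul, norm_pow, e] at h

theorem summable_one_add_int_sq_inv : Summable fun n : ℤ => (1 + (n : ℝ) ^ 2)⁻¹ := by
  refine Summable.of_norm_bounded_eventually
    (Real.summable_one_div_int_pow.2 one_lt_two) ?_
  filter_upwards [(Set.finite_singleton (0 : ℤ)).compl_mem_cofinite] with n hn
  have hn' : (n : ℝ) ≠ 0 := by exact_mod_cast hn
  rw [Real.norm_of_nonneg (by positivity), ← one_div]
  exact one_div_le_one_div_of_le (by positivity) (by linarith)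

/-- Since `|f̂(n)| ≤ M (1 + n²)^(-m)`, the condition `s + 1 ≤ 2m` leaves one spare factor `(1 +
n²)⁻¹`, which makes the series converge. -/
theorem sobolev_term_le {f : ℝ → ℝ} (hf : ContDiff ℝ ∞ f)
    (hp : Function.Periodic f L) {m : ℕ} {s M : ℝ} (hs : s + 1 ≤ 2 * m)
    (hM : ∀ x ∈ Set.Icc 0 L, |(besselOp L)^[m] f x| ≤ M) (n : ℤ) :
    (1 + (n : ℝ) ^ 2) ^ s * ‖periodicCoeff L f n‖ ^ 2 ≤ M ^ 2 * (1 + (n : ℝ) ^ 2)⁻¹ := by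
  have h1 : 1 ≤ 1 + (n : ℝ) ^ 2 := by nlinarith [sq_nonneg (n : ℝ)]
  have h := one_add_sq_pow_mul_norm_periodicCoeff_le hf hp hM n
  set b := 1 + (n : ℝ) ^ 2
  have hb : 0 < b := by linarith
  have h2 : b ^ s * b ≤ (b ^ m) ^ 2 := by
    rw [← pow_mul, ← Real.rpow_natCast b (m * 2), ← Real.rpow_add_one hb.ne']
    refine Real.rpow_le_rpow_of_exponent_le h1 ?_
    push_cast
    linarith
  rw [← div_eq_mul_inv, le_div_iff₀ hb]
  calc b ^ s * ‖periodicCoeff L f n‖ ^ 2 * b = b ^ s * b * ‖periodicCoeff L f n‖ ^ 2 := by ring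
    _ ≤ (b ^ m) ^ 2 * ‖periodicCoeff L f n‖ ^ 2 := by gcongr
    _ = (b ^ m * ‖periodicCoeff L f n‖) ^ 2 := by ring
    _ ≤ M ^ 2 := by gcongr

end PeriodicCoeff

/-! ### Smooth odd periodic functions as elements of `H^∞_{per,m}` -/

section SmoothOddPeriodic

/-- The space of smooth odd `L`-periodic functions. -/
def smoothOddPeriodic (L : ℝ) : Submodule ℝ (ℝ → ℝ) where
  carrier := {f | ContDiff ℝ ∞ f ∧ Function.Periodic f L ∧ Function.Odd f}
  zero_mem' := ⟨contDiff_const, fun _ => rfl, fun _ => by simp⟩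
  add_mem' := fun hf hg => ⟨hf.1.add hg.1, hf.2.1.add hg.2.1, fun x => by
    simp only [Pi.add_apply, hf.2.2 x, hg.2.2 x]
    ring⟩
  smul_mem' := fun a f hf => ⟨contDiff_const.smul hf.1, fun x => by
    simp only [Pi.smul_apply, hf.2.1 x], fun x => by
    simp only [Pi.smul_apply, hf.2.2 x, smul_neg]⟩

theorem smoothOddPeriodic.exists_besselOp_iterate_le {L : ℝ} (f : smoothOddPeriodic L) (m : ℕ) :
    ∃ M, ∀ x ∈ Set.Icc 0 L, |(besselOp L)^[m] (f : ℝ → ℝ) x| ≤ M :=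
  isCompact_Icc.exists_bound_of_continuousOn
    (f.2.1.besselOp_iterate L m).continuous.continuousOn

variable {L : ℝ} [hL : Fact (0 < L)]

namespace smoothOddPeriodic

/-- The continuous function on the circle given by a smooth odd periodic function. -/
def toCircleMap : smoothOddPeriodic L →ₗ[ℝ] C(AddCircle L, ℝ) where
  toFun f := ⟨f.2.2.1.lift, continuous_coinduced_dom.2 f.2.1.continuous⟩
  map_add' f g := by
    ext x
    induction x using QuotientAddGroup.induction_on with
    | H x => rfl
  map_smul' a f := by
    ext x
    induction x using QuotientAddGroup.induction_on with
    | H x => rfl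

/-- The class in `L²_per` of a smooth odd periodic function. -/
def toL2per : smoothOddPeriodic L →ₗ[ℝ] L2per L :=
  (ContinuousMap.toLp 2 haarAddCircle ℝ).toLinearMap ∘ₗ toCircleMap

theorem coeFn_toL2per (f : smoothOddPeriodic L) :
    (toL2per f : AddCircle L → ℝ) =ᵐ[haarAddCircle] toCircleMap f :=
  ContinuousMap.coeFn_toLp haarAddCircle (toCircleMap f)

theorem represents_toL2per (f : smoothOddPeriodic L) :
    Represents (toL2per f) (f : ℝ → ℝ) := by
  refine ⟨f.2.2.1, ?_⟩
  have h : (toL2per f : AddCircle L → ℝ) =ᵐ[volume] toCircleMap f := by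
    rw [volume_eq_smul_haarAddCircle]
    exact (Measure.smul_absolutelyContinuous (c := ENNReal.ofReal L)).ae_eq (coeFn_toL2per f)
  have hq := (AddCircle.measurePreserving_mk L 0).quasiMeasurePreserving.ae h
  rw [zero_add] at hq
  exact hq

theorem fhat_toL2per (f : smoothOddPeriodic L) (n : ℤ) :
    fhat (toL2per f) n = periodicCoeff L (f : ℝ → ℝ) n := by
  rw [← fourierCoeff_lift_eq_periodicCoeff f.2.2.1, fhat]
  refine congrFun (fourierCoeff_congr_ae ?_) n
  filter_upwards [coeFn_toL2per f] with x hx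
  rw [hx]
  rfl

/-- Haar measure is invariant under `x ↦ -x`, so the integral of an odd function equals its own
negative. -/
theorem toL2per_mem_zeroMean (f : smoothOddPeriodic L) : toL2per f ∈ zeroMean L := by
  change ∫ x, toL2per f x ∂haarAddCircle = 0
  rw [integral_congr_ae (coeFn_toL2per f)]
  have h := integral_neg_eq_self (toCircleMap f) (haarAddCircle : Measure (AddCircle L))
  have h2 : ∀ x, toCircleMap f (-x) = -toCircleMap f x := by
    intro x
    induction x using QuotientAddGroup.induction_on with
    | H x => exact f.2.2.2 x
  simp only [h2, integral_neg] at h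
  linarith

theorem toL2per_mem_sobolevSubmodule (f : smoothOddPeriodic L) (s : ℝ) :
    toL2per f ∈ sobolevSubmodule L s := by
  have hL0 : 0 < L := hL.out
  obtain ⟨m, hm⟩ := exists_nat_ge (s + 1)
  obtain ⟨M, hM⟩ := exists_besselOp_iterate_le f m
  rw [mem_sobolevSubmodule]
  have hm' : s + 1 ≤ 2 * m := by linarith [m.cast_nonneg (α := ℝ)]
  simp only [fhat_toL2per, mul_assoc]
  refine Summable.mul_left L (Summable.of_nonneg_of_le (fun n => by positivity)
    (sobolev_term_le f.2.1 f.2.2.1 hm' hM) (summable_one_add_int_sq_inv.mul_left _))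

/-- The element of `H^∞_{per,m}` given by a smooth odd periodic function. -/
def toHInf (f : smoothOddPeriodic L) : HInfperm L :=
  ⟨toL2per f, toL2per_mem_zeroMean f, (Submodule.mem_iInf _).2 fun s =>
    (Submodule.mem_iInf _).2 fun _ => toL2per_mem_sobolevSubmodule f s⟩

/-- The element of `H^s_{per,m}` given by a smooth odd periodic function. -/
def toHs {s : ℝ} (hs : 0 ≤ s) : smoothOddPeriodic L →ₗ[ℝ] Hperm L s where
  toFun f := HInfperm.toHperm hs (toHInf f)
  map_add' f g := Subtype.ext (Subtype.ext (map_add toL2per f g))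
  map_smul' a f := Subtype.ext (Subtype.ext (map_smul toL2per a f))

/-- The constant does not depend on `f`: uniform bounds on finitely many `x`-derivatives become
bounds in `H^s`. -/
theorem exists_norm_toHs_le {s : ℝ} (hs : 0 ≤ s) {m : ℕ} (hm : s + 1 ≤ 2 * m) :
    ∃ C > 0, ∀ (f : smoothOddPeriodic L) (M : ℝ),
      (∀ x ∈ Set.Icc 0 L, |(besselOp L)^[m] (f : ℝ → ℝ) x| ≤ M) → ‖toHs hs f‖ ≤ C * M := by
  have hL0 : 0 < L := hL.out
  have hS : 0 < ∑' n : ℤ, (1 + (n : ℝ) ^ 2)⁻¹ :=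
    summable_one_add_int_sq_inv.tsum_pos (fun n => by positivity) 0 (by simp)
  refine ⟨√(L * ∑' n : ℤ, (1 + (n : ℝ) ^ 2)⁻¹), by positivity, fun f M hM => ?_⟩
  have hM0 : 0 ≤ M := (abs_nonneg _).trans (hM 0 ⟨le_rfl, hL0.le⟩)
  refine abs_le_of_sq_le_sq' ?_ (by positivity) |>.2
  have h1 : ‖toHs hs f‖ ^ 2 =
      L * ∑' n : ℤ, (1 + (n : ℝ) ^ 2) ^ s * ‖fhat (toL2per f) n‖ ^ 2 :=
    Hper.norm_sq (toHs hs f : Hper L s)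
  have h2 := summable_one_add_int_sq_inv.mul_left (M ^ 2)
  have h3 := sobolev_term_le f.2.1 f.2.2.1 hm hM
  rw [h1, mul_pow, Real.sq_sqrt (by positivity), mul_assoc]
  refine mul_le_mul_of_nonneg_left ?_ hL0.le
  simp only [fhat_toL2per]
  rw [mul_comm, ← tsum_mul_left]
  exact (Summable.of_nonneg_of_le (fun n => by positivity) h3 h2).tsum_le_tsum h3 h2

end smoothOddPeriodic

end SmoothOddPeriodic

/-! ### Directional derivatives of functions of two variables -/

section Directional

/-- The derivative of `W` in the direction `v`, as a function of the base point. -/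
def dirDeriv (v : ℝ × ℝ) (W : ℝ × ℝ → ℝ) (p : ℝ × ℝ) : ℝ := fderiv ℝ W p v

variable {S : Set (ℝ × ℝ)} {W : ℝ × ℝ → ℝ}

theorem ContDiffOn.dirDeriv (hS : IsOpen S) (hW : ContDiffOn ℝ ∞ W S) (v : ℝ × ℝ) :
    ContDiffOn ℝ ∞ (dirDeriv v W) S :=
  (hW.fderiv_of_isOpen hS (by simp)).clm_apply contDiffOn_const

theorem Set.EqOn.dirDeriv (hS : IsOpen S) {W' : ℝ × ℝ → ℝ} (h : Set.EqOn W W' S)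
    (v : ℝ × ℝ) : Set.EqOn (dirDeriv v W) (dirDeriv v W') S := fun p hp => by
  rw [_root_.dirDeriv, (h.eventuallyEq_of_mem (hS.mem_nhds hp)).fderiv_eq, _root_.dirDeriv]

theorem ContDiffOn.hasFDerivAt_of_isOpen (hS : IsOpen S) (hW : ContDiffOn ℝ ∞ W S) {p : ℝ × ℝ}
    (hp : p ∈ S) : HasFDerivAt W (fderiv ℝ W p) p :=
  ((hW.contDiffAt (hS.mem_nhds hp)).differentiableAt (by simp)).hasFDerivAt

theorem dirDeriv_comm (hS : IsOpen S) (hW : ContDiffOn ℝ ∞ W S) (v w : ℝ × ℝ) :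
    Set.EqOn (dirDeriv v (dirDeriv w W)) (dirDeriv w (dirDeriv v W)) S := fun p hp => by
  have hd : DifferentiableAt ℝ (fderiv ℝ W) p :=
    ((hW.fderiv_of_isOpen (m := ∞) hS (by simp)).contDiffAt
      (hS.mem_nhds hp)).differentiableAt (by simp)
  have h : ∀ v w : ℝ × ℝ, dirDeriv v (dirDeriv w W) p = fderiv ℝ (fderiv ℝ W) p v w := by
    intro v w
    have := hd.hasFDerivAt.clm_apply (hasFDerivAt_const w p)
    change fderiv ℝ (fun y => fderiv ℝ W y w) p v = _
    rw [this.fderiv]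
    simp
  rw [h, h]
  exact (hW.contDiffAt (hS.mem_nhds hp)).isSymmSndFDerivAt
    (by rw [minSmoothness_of_isRCLikeNormedField]; exact WithTop.coe_le_coe.2 le_top) v w

theorem hasDerivAt_dirDeriv_fst (hS : IsOpen S) (hW : ContDiffOn ℝ ∞ W S) {c x : ℝ}
    (hp : (c, x) ∈ S) : HasDerivAt (fun t => W (t, x)) (dirDeriv (1, 0) W (c, x)) c :=
  (hW.hasFDerivAt_of_isOpen hS hp).comp_hasDerivAt (f := fun t : ℝ => (t, x)) c
    ((hasDerivAt_id c).prodMk (hasDerivAt_const c x))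

theorem hasDerivAt_dirDeriv_snd (hS : IsOpen S) (hW : ContDiffOn ℝ ∞ W S) {c x : ℝ}
    (hp : (c, x) ∈ S) : HasDerivAt (fun y => W (c, y)) (dirDeriv (0, 1) W (c, x)) x :=
  (hW.hasFDerivAt_of_isOpen hS hp).comp_hasDerivAt (f := fun y : ℝ => (c, y)) x
    ((hasDerivAt_const x c).prodMk (hasDerivAt_id x))

/-- The operator `besselOp L` acting on the second variable. -/
def besselOpSnd (L : ℝ) (W : ℝ × ℝ → ℝ) (p : ℝ × ℝ) : ℝ :=
  W p - (L / (2 * Real.pi)) ^ 2 * dirDeriv (0, 1) (dirDeriv (0, 1) W) p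

theorem ContDiffOn.besselOpSnd (hS : IsOpen S) (hW : ContDiffOn ℝ ∞ W S) (L : ℝ) :
    ContDiffOn ℝ ∞ (besselOpSnd L W) S :=
  hW.sub (contDiffOn_const.mul ((hW.dirDeriv hS _).dirDeriv hS _))

theorem ContDiffOn.besselOpSnd_iterate (hS : IsOpen S) (hW : ContDiffOn ℝ ∞ W S) (L : ℝ)
    (m : ℕ) : ContDiffOn ℝ ∞ ((_root_.besselOpSnd L)^[m] W) S := by
  induction m with
  | zero => exact hW
  | succ m ih =>
    rw [Function.iterate_succ_apply']
    exact ih.besselOpSnd hS L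

theorem Set.EqOn.besselOpSnd (hS : IsOpen S) {W' : ℝ × ℝ → ℝ} (h : Set.EqOn W W' S) (L : ℝ) :
    Set.EqOn (besselOpSnd L W) (besselOpSnd L W') S := fun p hp => by
  simp only [_root_.besselOpSnd, h hp, (h.dirDeriv hS (0, 1)).dirDeriv hS (0, 1) hp]

/-- The operator has constant coefficients, and directional derivatives of a smooth function
commute. -/
theorem dirDeriv_besselOpSnd (hS : IsOpen S) (hW : ContDiffOn ℝ ∞ W S) (v : ℝ × ℝ) (L : ℝ) :
    Set.EqOn (dirDeriv v (besselOpSnd L W)) (besselOpSnd L (dirDeriv v W)) S := fun p hp => by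
  have hW2 := (hW.dirDeriv hS (0, 1)).dirDeriv hS (0, 1)
  have h1 := (hW.hasFDerivAt_of_isOpen hS hp).sub
    ((hW2.hasFDerivAt_of_isOpen hS hp).const_mul ((L / (2 * Real.pi)) ^ 2))
  have h2 : dirDeriv v (besselOpSnd L W) p = dirDeriv v W p -
      (L / (2 * Real.pi)) ^ 2 * dirDeriv v (dirDeriv (0, 1) (dirDeriv (0, 1) W)) p := by
    rw [dirDeriv, HasFDerivAt.fderiv (f := besselOpSnd L W) h1]
    simp [dirDeriv]
  rw [h2, dirDeriv_comm hS (hW.dirDeriv hS _) v (0, 1) hp,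
    (dirDeriv_comm hS hW v (0, 1)).dirDeriv hS (0, 1) hp, besselOpSnd]

theorem dirDeriv_besselOpSnd_iterate (hS : IsOpen S) (hW : ContDiffOn ℝ ∞ W S) (v : ℝ × ℝ)
    (L : ℝ) (m : ℕ) :
    Set.EqOn (dirDeriv v ((besselOpSnd L)^[m] W)) ((besselOpSnd L)^[m] (dirDeriv v W)) S := by
  induction m with
  | zero => exact Set.eqOn_refl _ _
  | succ m ih =>
    simp only [Function.iterate_succ_apply']
    exact (dirDeriv_besselOpSnd hS (hW.besselOpSnd_iterate hS L m) v L).trans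
      (ih.besselOpSnd hS L)

end Directional

/-! ### Smooth families of periodic functions -/

section Families

variable {I : Set ℝ} {W : ℝ × ℝ → ℝ}

theorem contDiff_slice (hI : IsOpen I) (hW : ContDiffOn ℝ ∞ W (I ×ˢ Set.univ)) {c : ℝ}
    (hc : c ∈ I) : ContDiff ℝ ∞ fun x => W (c, x) :=
  contDiff_iff_contDiffAt.2 fun x =>
    (hW.contDiffAt ((hI.prod isOpen_univ).mem_nhds ⟨hc, trivial⟩)).comp x (by fun_prop)

theorem besselOp_slice (hI : IsOpen I) (hW : ContDiffOn ℝ ∞ W (I ×ˢ Set.univ)) {c : ℝ}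
    (hc : c ∈ I) (L : ℝ) :
    besselOp L (fun x => W (c, x)) = fun x => besselOpSnd L W (c, x) := by
  have hS : IsOpen (I ×ˢ (Set.univ : Set ℝ)) := hI.prod isOpen_univ
  have h : ∀ {W : ℝ × ℝ → ℝ}, ContDiffOn ℝ ∞ W (I ×ˢ Set.univ) →
      deriv (fun x => W (c, x)) = fun x => dirDeriv (0, 1) W (c, x) := fun hW =>
    funext fun x => (hasDerivAt_dirDeriv_snd hS hW ⟨hc, trivial⟩).deriv
  funext x
  rw [besselOp, h hW, h (hW.dirDeriv hS _), besselOpSnd]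

theorem besselOp_iterate_slice (hI : IsOpen I) (hW : ContDiffOn ℝ ∞ W (I ×ˢ Set.univ)) {c : ℝ}
    (hc : c ∈ I) (L : ℝ) (m : ℕ) :
    (besselOp L)^[m] (fun x => W (c, x)) = fun x => (besselOpSnd L)^[m] W (c, x) := by
  induction m with
  | zero => rfl
  | succ m ih =>
    simp only [Function.iterate_succ_apply', ih]
    exact besselOp_slice hI (hW.besselOpSnd_iterate (hI.prod isOpen_univ) L m) hc L

/-- The mean value inequality is applied to `r ↦ W(r, x) - r ∂_c W(c, x)`. Its derivative is below
`η` near `c`, uniformly in `x` by compactness of `[0, L]`. -/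
theorem eventually_remainder_le (hI : IsOpen I) (hW : ContDiffOn ℝ ∞ W (I ×ˢ Set.univ)) {c : ℝ}
    (hc : c ∈ I) (L : ℝ) {η : ℝ} (hη : 0 < η) :
    ∀ᶠ t in nhds c, ∀ x ∈ Set.Icc 0 L,
      |W (t, x) - W (c, x) - (t - c) * dirDeriv (1, 0) W (c, x)| ≤ η * |t - c| := by
  have hS : IsOpen (I ×ˢ (Set.univ : Set ℝ)) := hI.prod isOpen_univ
  have hW1 := hW.dirDeriv hS (1, 0)
  have hcont : ∀ x, ContinuousAt (dirDeriv (1, 0) W) (c, x) := fun x =>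
    hW1.continuousOn.continuousAt (hS.mem_nhds ⟨hc, trivial⟩)
  have h1 : ∀ᶠ t in nhds c, ∀ x ∈ Set.Icc 0 L,
      |dirDeriv (1, 0) W (t, x) - dirDeriv (1, 0) W (c, x)| < η := by
    refine isCompact_Icc.eventually_forall_of_forall_eventually fun x _ => ?_
    have h2 : ContinuousAt (fun z : ℝ × ℝ =>
        |dirDeriv (1, 0) W (z.1, z.2) - dirDeriv (1, 0) W (c, z.2)|) (c, x) :=
      ((hcont x).sub ((hcont x).comp (x := (c, x))
        (f := fun z : ℝ × ℝ => (c, z.2)) (by fun_prop))).abs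
    refine h2.eventually (gt_mem_nhds ?_)
    simpa using hη
  obtain ⟨δ, hδ, hball⟩ := Metric.eventually_nhds_iff_ball.1 (h1.and (hI.mem_nhds hc))
  filter_upwards [Metric.ball_mem_nhds c hδ] with t ht x hx
  have h3 := (convex_ball c δ).norm_image_sub_le_of_norm_hasDerivWithin_le
    (f := fun r => W (r, x) - r * dirDeriv (1, 0) W (c, x))
    (f' := fun r => dirDeriv (1, 0) W (r, x) - dirDeriv (1, 0) W (c, x)) (C := η)
    (fun r hr => by
      have := (hasDerivAt_dirDeriv_fst hS hW (x := x) ⟨(hball r hr).2, trivial⟩).sub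
        ((hasDerivAt_id r).mul_const (dirDeriv (1, 0) W (c, x)))
      rw [one_mul] at this
      exact this.hasDerivWithinAt)
    (fun r hr => ((hball r hr).1 x hx).le) (Metric.mem_ball_self hδ) ht
  rw [Real.norm_eq_abs, Real.norm_eq_abs] at h3
  convert h3 using 2
  ring

variable {L : ℝ}

theorem dirDeriv_fst_mem_smoothOddPeriodic (hI : IsOpen I)
    (hW : ContDiffOn ℝ ∞ W (I ×ˢ Set.univ))
    (hP : ∀ c ∈ I, (fun x => W (c, x)) ∈ smoothOddPeriodic L) {c : ℝ} (hc : c ∈ I) :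
    (fun x => dirDeriv (1, 0) W (c, x)) ∈ smoothOddPeriodic L := by
  have hS : IsOpen (I ×ˢ (Set.univ : Set ℝ)) := hI.prod isOpen_univ
  have hd : ∀ x, HasDerivAt (fun t => W (t, x)) (dirDeriv (1, 0) W (c, x)) c := fun x =>
    hasDerivAt_dirDeriv_fst hS hW ⟨hc, trivial⟩
  refine ⟨contDiff_slice hI (hW.dirDeriv hS _) hc, fun x => ?_, fun x => ?_⟩
  · refine (hd (x + L)).unique ((hd x).congr_of_eventuallyEq ?_)
    filter_upwards [hI.mem_nhds hc] with t ht
    exact (hP t ht).2.1 x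
  · refine (hd (-x)).unique ((hd x).neg.congr_of_eventuallyEq ?_)
    filter_upwards [hI.mem_nhds hc] with t ht
    exact (hP t ht).2.2 x

variable [hL : Fact (0 < L)]

open Classical in
/-- The element of `H^∞_{per,m}` given by a real function: zero unless the function is smooth,
odd and periodic. -/
def hInfOf (L : ℝ) [hL : Fact (0 < L)] (f : ℝ → ℝ) : HInfperm L :=
  if hf : f ∈ smoothOddPeriodic L then smoothOddPeriodic.toHInf ⟨f, hf⟩ else 0

theorem hInfOf_of_mem {f : ℝ → ℝ} (hf : f ∈ smoothOddPeriodic L) :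
    hInfOf L f = smoothOddPeriodic.toHInf ⟨f, hf⟩ := dif_pos hf

/-- Applying `B^m` to the remainder of `W` gives the remainder of `B^m W`, since `B^m` is linear and
commutes with `∂_c`. The uniform remainder estimate then bounds the `H^s` norm. -/
theorem hasDerivAt_toHperm_hInfOf {s : ℝ} (hs : 0 ≤ s) (hI : IsOpen I)
    (hW : ContDiffOn ℝ ∞ W (I ×ˢ Set.univ))
    (hP : ∀ c ∈ I, (fun x => W (c, x)) ∈ smoothOddPeriodic L) {c : ℝ} (hc : c ∈ I) :
    HasDerivAt (fun c => HInfperm.toHperm hs (hInfOf L fun x => W (c, x)))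
      (HInfperm.toHperm hs (hInfOf L fun x => dirDeriv (1, 0) W (c, x))) c := by
  have hS : IsOpen (I ×ˢ (Set.univ : Set ℝ)) := hI.prod isOpen_univ
  obtain ⟨m, hm⟩ := exists_nat_ge (s + 1)
  obtain ⟨C, hC, hbound⟩ := smoothOddPeriodic.exists_norm_toHs_le (L := L) hs (m := m)
    (by linarith [m.cast_nonneg (α := ℝ)])
  have hP1 := dirDeriv_fst_mem_smoothOddPeriodic hI hW hP hc
  have hV := hW.besselOpSnd_iterate hS L m
  rw [hasDerivAt_iff_isLittleO, Asymptotics.isLittleO_iff]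
  intro ε hε
  filter_upwards [eventually_remainder_le hI hV hc L (div_pos hε hC), hI.mem_nhds hc]
    with t ht htI
  set f₁ : smoothOddPeriodic L := ⟨_, hP1⟩
  -- The remainder is the image of a single smooth odd periodic function, to which the sup bound
  -- `hbound` applies.
  have e : HInfperm.toHperm hs (hInfOf L fun x => W (t, x)) -
      HInfperm.toHperm hs (hInfOf L fun x => W (c, x)) -
      (t - c) • HInfperm.toHperm hs (hInfOf L fun x => dirDeriv (1, 0) W (c, x)) =
      smoothOddPeriodic.toHs hs
        (⟨_, hP t htI⟩ + (-1 : ℝ) • ⟨_, hP c hc⟩ + (-(t - c)) • f₁) := by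
    rw [hInfOf_of_mem (hP t htI), hInfOf_of_mem (hP c hc), hInfOf_of_mem hP1, map_add, map_add,
      map_smul, map_smul, neg_one_smul, neg_smul, ← sub_eq_add_neg, ← sub_eq_add_neg]
    rfl
  rw [e, Real.norm_eq_abs]
  refine (hbound _ (ε / C * |t - c|) fun x hx => ?_).trans_eq (by field_simp)
  have hsm := fun c hc => contDiff_slice (c := c) hI hW hc
  have hadd : ContDiff ℝ ∞ ((fun x => W (t, x)) + (-1 : ℝ) • fun x => W (c, x)) :=
    (hsm t htI).add (contDiff_const.smul (hsm c hc))
  have hD : (besselOp L)^[m] ((fun x => W (t, x)) + (-1 : ℝ) • (fun x => W (c, x)) +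
      (-(t - c)) • fun x => dirDeriv (1, 0) W (c, x)) x =
      (besselOpSnd L)^[m] W (t, x) - (besselOpSnd L)^[m] W (c, x) -
      (t - c) * dirDeriv (1, 0) ((besselOpSnd L)^[m] W) (c, x) := by
    rw [besselOp_iterate_add_smul hadd hP1.1,
      besselOp_iterate_add_smul (hsm t htI) (hsm c hc), besselOp_iterate_slice hI hW htI,
      besselOp_iterate_slice hI hW hc, besselOp_iterate_slice hI (hW.dirDeriv hS _) hc,
      dirDeriv_besselOpSnd_iterate hS hW (1, 0) L m ⟨hc, trivial⟩]
    simp only [Pi.add_apply, Pi.smul_apply, smul_eq_mul]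
    ring
  exact (congrArg abs hD).trans_le (ht x hx)

/-- The induction generalizes `W`, because the derivative of the curve is the curve attached to `∂_c
W`, which meets the same hypotheses. -/
theorem contDiffOn_toHperm_hInfOf {s : ℝ} (hs : 0 ≤ s) (hI : IsOpen I) (n : ℕ)
    (hW : ContDiffOn ℝ ∞ W (I ×ˢ Set.univ))
    (hP : ∀ c ∈ I, (fun x => W (c, x)) ∈ smoothOddPeriodic L) :
    ContDiffOn ℝ n (fun c => HInfperm.toHperm hs (hInfOf L fun x => W (c, x))) I := by
  induction n generalizing W with
  | zero =>
    exact contDiffOn_zero.2 fun c hc =>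
      (hasDerivAt_toHperm_hInfOf hs hI hW hP hc).continuousAt.continuousWithinAt
  | succ n ih =>
    rw [Nat.cast_succ, contDiffOn_succ_iff_deriv_of_isOpen hI]
    refine ⟨fun c hc => (hasDerivAt_toHperm_hInfOf hs hI hW
      hP hc).differentiableAt.differentiableWithinAt, by simp, ?_⟩
    exact (ih (hW.dirDeriv (hI.prod isOpen_univ) (1, 0)) fun c hc =>
      dirDeriv_fst_mem_smoothOddPeriodic hI hW hP hc).congr fun c hc =>
        (hasDerivAt_toHperm_hInfOf hs hI hW hP hc).deriv

theorem smoothCurveOn_hInfOf (hI : IsOpen I) (hW : ContDiffOn ℝ ∞ W (I ×ˢ Set.univ))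
    (hP : ∀ c ∈ I, (fun x => W (c, x)) ∈ smoothOddPeriodic L) :
    SmoothCurveOn (fun c => hInfOf L fun x => W (c, x)) I := fun _ hs =>
  contDiffOn_infty.2 fun n => contDiffOn_toHperm_hInfOf hs hI n hW hP

end Families

/-! ### The snoidal waves -/

section SnoidalWave

variable {L : ℝ}

theorem snoidalWave_neg {k : ℝ} (h0 : 0 < k) (h1 : k < 1) (c : ℝ) :
    Function.Odd (snoidalWave c k) := fun x => by
  rw [snoidalWave, mul_neg, jacobiSn_neg h0.le h1, mul_neg, snoidalWave]

theorem snoidalWave_periodic {k c : ℝ} (hL : 0 < L) (h0 : 0 < k) (h1 : k < 1) (hc : c ^ 2 < 1)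
    (hk : 1 / √(1 - c ^ 2) = 4 * ellipticK k * √(1 + k ^ 2) / L) :
    Function.Periodic (snoidalWave c k) L := fun x => by
  have hω : 0 < 1 - c ^ 2 := by linarith
  -- The equation for `k` says exactly that `x ↦ x + L` shifts the argument of `sn` by its period
  -- `4K`.
  have hb : 1 / √((1 - c ^ 2) * (1 + k ^ 2)) * L = 4 * ellipticK k := by
    have hs : 0 < √(1 + k ^ 2) := by positivity
    rw [Real.sqrt_mul hω.le, ← one_div_mul_one_div, hk]
    field_simp
  rw [snoidalWave, mul_add, hb, jacobiSn_add h0.le h1, snoidalWave]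

/-- With amplitude `A` and scale `b`, the value of `b²` cancels the linear terms and `A² = 2k² / (1
+ k²)` the cubic ones. -/
theorem snoidalWave_ode {k c : ℝ} (h0 : 0 < k) (h1 : k < 1) (hc : c ^ 2 < 1) (x : ℝ) :
    -(1 - c ^ 2) * iteratedDeriv 2 (snoidalWave c k) x
      - snoidalWave c k x + snoidalWave c k x ^ 3 = 0 := by
  have hω : 0 < 1 - c ^ 2 := by linarith
  set A := √2 * k / √(k ^ 2 + 1) with hA
  set b := 1 / √((1 - c ^ 2) * (1 + k ^ 2)) with hb
  have hA2 : A ^ 2 = 2 * k ^ 2 / (1 + k ^ 2) := by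
    rw [hA, div_pow, mul_pow, Real.sq_sqrt (by norm_num), Real.sq_sqrt (by positivity), add_comm]
  have hb2 : b ^ 2 = 1 / ((1 - c ^ 2) * (1 + k ^ 2)) := by
    rw [hb, div_pow, Real.sq_sqrt (by positivity), one_pow]
  have hlin : ∀ x, HasDerivAt (fun x => b * x) b x := fun x => by
    simpa using (hasDerivAt_id x).const_mul b
  have hd1 : deriv (snoidalWave c k) = fun x => A * ((Real.cos (jacobiAm (b * x) k) *
      √(1 - k ^ 2 * jacobiSn (b * x) k ^ 2)) * b) := funext fun x =>
    (((hasDerivAt_jacobiSn h0 h1 (b * x)).comp x (hlin x)).const_mul A).deriv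
  have hd2 : iteratedDeriv 2 (snoidalWave c k) x =
      A * ((-(1 + k ^ 2) * jacobiSn (b * x) k + 2 * k ^ 2 * jacobiSn (b * x) k ^ 3) * b * b) := by
    rw [iteratedDeriv_succ, iteratedDeriv_one, hd1]
    exact ((((hasDerivAt_deriv_jacobiSn h0 h1 (b * x)).comp x (hlin x)).mul_const
      b).const_mul A).deriv
  have hw : snoidalWave c k x = A * jacobiSn (b * x) k := rfl
  rw [hd2, hw]
  set y := jacobiSn (b * x) k
  have e : -(1 - c ^ 2) * (A * ((-(1 + k ^ 2) * y + 2 * k ^ 2 * y ^ 3) * b * b)) - A * y +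
      (A * y) ^ 3 = A * (-(1 - c ^ 2) * b ^ 2 * (-(1 + k ^ 2) * y + 2 * k ^ 2 * y ^ 3) - y +
      A ^ 2 * y ^ 3) := by ring
  rw [e, hA2, hb2]
  field_simp
  ring

theorem contDiffAt_snoidalWave {κ : ℝ → ℝ} {c x : ℝ} (hκ : ContDiffAt ℝ ∞ κ c) (h0 : 0 < κ c)
    (h1 : κ c < 1) (hc : c ^ 2 < 1) :
    ContDiffAt ℝ ∞ (fun p : ℝ × ℝ => snoidalWave p.1 (κ p.1) p.2) (c, x) := by
  have hω : 0 < 1 - c ^ 2 := by linarith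
  have hk : ContDiffAt ℝ ∞ (fun p : ℝ × ℝ => κ p.1) (c, x) :=
    ContDiffAt.comp (c, x) (f := Prod.fst) (g := κ) hκ contDiffAt_fst
  have hk2 : ContDiffAt ℝ ∞ (fun p : ℝ × ℝ => κ p.1 ^ 2 + 1) (c, x) :=
    (hk.pow 2).add contDiffAt_const
  have hk3 : ContDiffAt ℝ ∞ (fun p : ℝ × ℝ => 1 + κ p.1 ^ 2) (c, x) :=
    contDiffAt_const.add (hk.pow 2)
  have hp : 0 < (1 - c ^ 2) * (1 + κ c ^ 2) := by positivity
  have hA : ContDiffAt ℝ ∞ (fun p : ℝ × ℝ => √2 * κ p.1 / √(κ p.1 ^ 2 + 1)) (c, x) :=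
    (contDiffAt_const.mul hk).div
      (hk2.sqrt (by positivity : κ c ^ 2 + 1 ≠ 0)) (by positivity : √(κ c ^ 2 + 1) ≠ 0)
  have hb : ContDiffAt ℝ ∞
      (fun p : ℝ × ℝ => 1 / √((1 - p.1 ^ 2) * (1 + κ p.1 ^ 2)) * p.2) (c, x) :=
    (contDiffAt_const.div (ContDiffAt.sqrt (ContDiffAt.mul (by fun_prop) hk3) hp.ne')
      (Real.sqrt_pos.2 hp).ne').mul contDiffAt_snd
  have hsn : ContDiffAt ℝ ∞ (fun p : ℝ × ℝ =>
      jacobiSn (1 / √((1 - p.1 ^ 2) * (1 + κ p.1 ^ 2)) * p.2) (κ p.1)) (c, x) :=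
    ContDiffAt.comp (c, x) (g := fun p : ℝ × ℝ => jacobiSn p.1 p.2)
      (f := fun p : ℝ × ℝ => (1 / √((1 - p.1 ^ 2) * (1 + κ p.1 ^ 2)) * p.2, κ p.1))
      (contDiffAt_jacobiSn h0 h1) (hb.prodMk hk)
  exact hA.mul hsn

/-- Injectivity of `snoidalPeriod` on `(0, 1)` forces `κ` to be its inverse composed with `y`, so
`κ` is smooth although not even its continuity is assumed. -/
theorem contDiffAt_of_snoidalPeriod_eq {κ y : ℝ → ℝ} {c : ℝ} (hy : ContDiffAt ℝ ∞ y c)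
    (hκ : ∀ᶠ t in nhds c, 0 < κ t ∧ κ t < 1 ∧ snoidalPeriod (κ t) = y t) :
    ContDiffAt ℝ ∞ κ c := by
  obtain ⟨h0, h1, hq⟩ := hκ.self_of_nhds
  obtain ⟨d, hd, hder⟩ := exists_hasDerivAt_snoidalPeriod h0 h1
  have hinj : Set.InjOn snoidalPeriod (Set.Ioo 0 1) :=
    strictMonoOn_snoidalPeriod.injOn.mono Set.Ioo_subset_Ico_self
  have hinv := contDiffAt_of_eventually_leftInverse_real (n := ∞)
    (g := Function.invFunOn snoidalPeriod (Set.Ioo 0 1))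
    (contDiffAt_snoidalPeriod (by nlinarith)) hder hd.ne' (by simp)
    (by
      filter_upwards [isOpen_Ioo.mem_nhds (⟨h0, h1⟩ : κ c ∈ Set.Ioo 0 1)] with k hk
      exact hinj.leftInvOn_invFunOn hk)
  rw [hq] at hinv
  refine (hinv.comp c hy).congr_of_eventuallyEq ?_
  filter_upwards [hκ] with t ht
  rw [Function.comp_apply, ← ht.2.2]
  exact (hinj.leftInvOn_invFunOn ⟨ht.1, ht.2.1⟩).symm

theorem pi_div_two_lt_of_speed (hL0 : 0 < L) {c : ℝ}
    (hc : √(1 - L ^ 2 / (4 * Real.pi ^ 2)) < |c|) (hc1 : |c| < 1) :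
    Real.pi / 2 < L / (4 * √(1 - c ^ 2)) := by
  have hpi := Real.pi_pos
  have hc2 : c ^ 2 < 1 := (sq_lt_one_iff_abs_lt_one c).2 hc1
  have hω : 0 < 1 - c ^ 2 := by linarith
  have h1 : 1 - L ^ 2 / (4 * Real.pi ^ 2) < c ^ 2 := by
    rw [← sq_abs c]
    exact Real.lt_sq_of_sqrt_lt hc
  have h2 : √(1 - c ^ 2) < L / (2 * Real.pi) := by
    rw [Real.sqrt_lt' (by positivity), div_pow, mul_pow]
    norm_num
    linarith
  rw [lt_div_iff₀ (by positivity)]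
  rw [lt_div_iff₀ (by positivity)] at h2
  linarith

theorem one_div_sqrt_eq_iff {c k : ℝ} (hL0 : 0 < L) (hc1 : |c| < 1) :
    1 / √(1 - c ^ 2) = 4 * ellipticK k * √(1 + k ^ 2) / L ↔
      snoidalPeriod k = L / (4 * √(1 - c ^ 2)) := by
  have hc2 : c ^ 2 < 1 := (sq_lt_one_iff_abs_lt_one c).2 hc1
  have hω : 0 < √(1 - c ^ 2) := Real.sqrt_pos.2 (by linarith)
  rw [snoidalPeriod, div_eq_div_iff hω.ne' hL0.ne', eq_div_iff (by positivity)]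
  constructor <;> intro h <;> linarith

end SnoidalWave

end

theorem proposition3p1 (L : ℝ) [Fact (0 < L)] (hL : L < 2 * Real.pi) :
    ∃ (k : ℝ → ℝ) (h : ℝ → HInfperm L),
      (∀ c : ℝ, √(1 - L ^ 2 / (4 * Real.pi ^ 2)) < |c| → |c| < 1 →
        (0 < k c ∧ k c < 1 ∧
          1 / √(1 - c ^ 2) = 4 * ellipticK (k c) * √(1 + k c ^ 2) / L) ∧
        (∀ κ : ℝ, 0 < κ → κ < 1 →
          1 / √(1 - c ^ 2) = 4 * ellipticK κ * √(1 + κ ^ 2) / L → κ = k c) ∧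
        Represents (h c : L2per L) (snoidalWave c (k c)) ∧
        ContDiff ℝ ∞ (snoidalWave c (k c)) ∧
        Function.Odd (snoidalWave c (k c)) ∧
        ∀ x : ℝ, -(1 - c ^ 2) * iteratedDeriv 2 (snoidalWave c (k c)) x
          - snoidalWave c (k c) x + snoidalWave c (k c) x ^ 3 = 0) ∧
      SmoothCurveOn h {c | √(1 - L ^ 2 / (4 * Real.pi ^ 2)) < |c| ∧ |c| < 1} := by
  have hL0 : 0 < L := Fact.out
  set I := {c : ℝ | √(1 - L ^ 2 / (4 * Real.pi ^ 2)) < |c| ∧ |c| < 1}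
  have hI : IsOpen I :=
    (isOpen_lt continuous_const continuous_abs).inter (isOpen_lt continuous_abs continuous_const)
  have hsq : ∀ c ∈ I, c ^ 2 < 1 := fun c hc => (sq_lt_one_iff_abs_lt_one c).2 hc.2
  have hex : ∀ c : ℝ, ∃ k : ℝ, c ∈ I →
      (0 < k ∧ k < 1 ∧ snoidalPeriod k = L / (4 * √(1 - c ^ 2))) ∧
      ∀ l, 0 < l → l < 1 → snoidalPeriod l = L / (4 * √(1 - c ^ 2)) → l = k := fun c => by
    by_cases hc : c ∈ I
    · obtain ⟨k, hk⟩ := existsUnique_snoidalPeriod_eq (pi_div_two_lt_of_speed hL0 hc.1 hc.2)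
      exact ⟨k, fun _ => hk⟩
    · exact ⟨0, fun h => absurd h hc⟩
  choose k hk using hex
  have hksmooth : ∀ c ∈ I, ContDiffAt ℝ ∞ k c := fun c hc => by
    have hω : 0 < 1 - c ^ 2 := by linarith [hsq c hc]
    refine contDiffAt_of_snoidalPeriod_eq (y := fun c => L / (4 * √(1 - c ^ 2))) ?_ ?_
    · exact contDiffAt_const.div (contDiffAt_const.mul
        (ContDiffAt.sqrt (by fun_prop) hω.ne')) (by positivity)
    · filter_upwards [hI.mem_nhds hc] with t ht
      exact (hk t ht).1
  have hW : ContDiffOn ℝ ∞ (fun p : ℝ × ℝ => snoidalWave p.1 (k p.1) p.2)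
      (I ×ˢ Set.univ) := fun p hp =>
    (contDiffAt_snoidalWave (hksmooth p.1 hp.1) (hk p.1 hp.1).1.1 (hk p.1 hp.1).1.2.1
      (hsq p.1 hp.1)).contDiffWithinAt
  have hP : ∀ c ∈ I, snoidalWave c (k c) ∈ smoothOddPeriodic L := fun c hc => by
    obtain ⟨⟨h0, h1, hq⟩, -⟩ := hk c hc
    exact ⟨contDiff_slice hI hW hc, snoidalWave_periodic hL0 h0 h1 (hsq c hc)
      ((one_div_sqrt_eq_iff hL0 hc.2).2 hq), snoidalWave_neg h0 h1 c⟩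
  refine ⟨k, fun c => hInfOf L (snoidalWave c (k c)), fun c hc hc1 => ?_,
    smoothCurveOn_hInfOf hI hW hP⟩
  have hcI : c ∈ I := ⟨hc, hc1⟩
  obtain ⟨⟨h0, h1, hq⟩, huniq⟩ := hk c hcI
  refine ⟨⟨h0, h1, (one_div_sqrt_eq_iff hL0 hc1).2 hq⟩, fun κ hκ0 hκ1 hκ =>
    huniq κ hκ0 hκ1 ((one_div_sqrt_eq_iff hL0 hc1).1 hκ), ?_, (hP c hcI).1, (hP c hcI).2.2,
    snoidalWave_ode h0 h1 (hsq c hcI)⟩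
  change Represents (hInfOf L (snoidalWave c (k c)) : L2per L) _
  rw [hInfOf_of_mem (hP c hcI)]
  exact smoothOddPeriodic.represents_toL2per _
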